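/- Let $\mathbb{K}$ be an algebraically closed field of characteristic zero, let $q\ge 2$ be an integer, and let $E=\bigoplus_{\lambda=1}^{q}\mathbb{K}x^\lambda$. A quadratic algebra on the $q$ generators $x^\lambda$ is an algebra $A(E,R)=T(E)/(R)$, where $R\subset E\otimes E$ is a subspace and $(R)$ is the two-sided ideal it generates in the tensor algebra. Put $W_0=\mathbb{K}$, $W_1=E$ and $W_n=\bigcap_{i+2+j=n}E^{\otimes i}\otimes R\otimes E^{\otimes j}$ for $n\ge2$. The algebra $\mathcal{A}=A(E,R)$ is Koszul if its Koszul complex of left modules $$\cdots\to\mathcal{A}\otimes W_{n+1}\to\mathcal{A}\otimes W_n\to\cdots\to\mathcal{A}\otimes W_0,\qquad a\otimes(v_0\otimes\cdots\otimes v_n)\mapsto av_0\otimes(v_1\otimes\cdots\otimes v_n),$$ is acyclic in positive degrees. Its global dimension is its left global dimension. When this is $D$, $\mathcal{A}$ is Gorenstein if $\mathrm{Ext}^n_{\mathcal{A}}(\mathbb{K},\mathcal{A})=0$ for $n\ne D$ and $\mathrm{Ext}^D_{\mathcal{A}}(\mathbb{K},\mathcal{A})\cong\mathbb{K}$ as right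 $\mathcal{A}$-modules, where $\mathbb{K}$ is the trivial module (all $x^\lambda$ act by $0$). For a bilinear form $B$ on $\mathbb{K}^q$ with components $B_{\mu\nu}=B(e_\mu,e_\nu)$ in the canonical basis, let $\mathcal{A}(B)$ be the quadratic algebra with generators $x^\lambda$, $\lambda\in\{1,\dots,q\}$, and the single relation $\sum_{\mu,\nu}B_{\mu\nu}x^\mu x^\nu=0$. **Theorem 2.1.** 1. If $B$ is a nondegenerate bilinear form on $\mathbb{K}^q$, then $\mathcal{A}(B)$ is Koszul of global dimension $2$ and Gorenstein. 2. Conversely, let $\mathcal{A}=A(E,R)$ be a quadratic algebra on the $q$ generators $x^\lambda$ which is Koszul of global dimension $2$ and Gorenstein. Then there is a nondegenerate bilinear form $B$ on $\mathbb{K}^q$ such that $R$ is spanned by $\sum_{\mu,\nu}B_{\mu\nu}x^\mu\otimes x^\nu$, that is, $\mathcal{A}=\mathcal{A}(B)$. 3. If two nondegenerate bilinear forms $B,B'$ on $\mathbb{K}^q$ are on the same $GL(q,\mathbb{K})$-orbit, that is, $B'(X,Y)=B(L^{-1}X,L^{-1}Y)$ for some $L\in GL(q,\mathbb{K})$, then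 there is an isomorphism of algebras $\mathcal{A}(B)\cong\mathcal{A}(B')$ which maps the linear span of the generators of $\mathcal{A}(B)$ onto that of $\mathcal{A}(B')$. -/

import Mathlib

open CategoryTheory TensorProduct

universe u

noncomputable section

section FreeTensorAlgebra

/-! The free algebra `FreeAlgebra K (Fin q)` is the tensor algebra `T(E)` of the vector space
`E = ⊕ K x^i` with basis the generators `x^i = FreeAlgebra.ι K i`; the product of subspaces in it
is the tensor product of subspaces of the tensor powers of `E`. -/

variable (K : Type u) [Field K] (q : ℕ)

/-- The space of generators `E`, as the degree one part of the tensor algebra. -/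
def genSpace : Submodule K (FreeAlgebra K (Fin q)) :=
  Submodule.span K (Set.range (FreeAlgebra.ι K))

/-- The linear map of the tensor algebra that strips off the letter `x^i` on the left: it sends
`x^j v` to `v` if `i = j` and to `0` if `i ≠ j`, and it sends `1` to `0`.
Thus the canonical map `E ⊗ n+1 → E ⊗ (E ⊗ n)` is `f ↦ ∑ i, x^i ⊗ stripLeft i f`. -/
def stripLeft (i : Fin q) : FreeAlgebra K (Fin q) →ₗ[K] FreeAlgebra K (Fin q) :=
  (FreeAlgebra.basisFreeMonoid K (Fin q)).constr K fun w : FreeMonoid (Fin q) =>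
    match FreeMonoid.toList w with
    | [] => 0
    | j :: t => if i = j then FreeAlgebra.basisFreeMonoid K (Fin q) (FreeMonoid.ofList t) else 0

variable {K q}

theorem basisFreeMonoid_apply (w : FreeMonoid (Fin q)) :
    FreeAlgebra.basisFreeMonoid K (Fin q) w = FreeMonoid.lift (FreeAlgebra.ι K) w := by
  simp [FreeAlgebra.basisFreeMonoid, FreeAlgebra.equivMonoidAlgebraFreeMonoid]

theorem stripLeft_ι_mul (i j : Fin q) (f : FreeAlgebra K (Fin q)) :
    stripLeft K q i (FreeAlgebra.ι K j * f) = if i = j then f else 0 := by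
  have key : stripLeft K q i ∘ₗ LinearMap.mulLeft K (FreeAlgebra.ι K j) =
      if i = j then LinearMap.id else 0 := by
    refine (FreeAlgebra.basisFreeMonoid K (Fin q)).ext fun w => ?_
    have hw : FreeAlgebra.ι K j * FreeAlgebra.basisFreeMonoid K (Fin q) w =
        FreeAlgebra.basisFreeMonoid K (Fin q) (FreeMonoid.of j * w) := by
      simp [basisFreeMonoid_apply]
    rw [LinearMap.comp_apply, LinearMap.mulLeft_apply, hw, stripLeft, Module.Basis.constr_basis]
    simp only [FreeMonoid.toList_of_mul, FreeMonoid.ofList_toList]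
    split_ifs <;> rfl
  have h := LinearMap.congr_fun key f
  rw [LinearMap.comp_apply, LinearMap.mulLeft_apply] at h
  rw [h]
  split_ifs <;> rfl

/-- Stripping a letter maps `E S` into `S`. -/
theorem stripLeft_mem_of_mem_genSpace_mul (i : Fin q) (S : Submodule K (FreeAlgebra K (Fin q)))
    {f : FreeAlgebra K (Fin q)} (hf : f ∈ genSpace K q * S) : stripLeft K q i f ∈ S := by
  suffices h : genSpace K q * S ≤ S.comap (stripLeft K q i) from h hf
  rw [Submodule.mul_le]
  intro m hm s hs
  rw [Submodule.mem_comap]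
  induction hm using Submodule.span_induction with
  | mem x hx =>
    obtain ⟨j, rfl⟩ := hx
    rw [stripLeft_ι_mul]
    split_ifs
    · exact hs
    · exact S.zero_mem
  | zero => simp
  | add x y _ _ hx hy =>
    rw [add_mul, map_add]
    exact S.add_mem hx hy
  | smul c x _ hx =>
    rw [smul_mul_assoc, map_smul]
    exact S.smul_mem c hx

end FreeTensorAlgebra

section Homological

variable {K : Type u} [Field K] {A : Type u} [Ring A] [Algebra K A]

/-- The left global dimension of a ring: the supremum of the projective dimensions of all
left modules. -/
def leftGlobalDimension (A : Type u) [Ring A] : WithBot ℕ∞ :=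
  ⨆ M : ModuleCat.{u} A, projectiveDimension M

/-- The trivial left module `K` of an algebra with augmentation `ε`: `a • k = ε a * k`. -/
def trivialModule (ε : A →ₐ[K] K) : ModuleCat.{u} A :=
  (ModuleCat.restrictScalars ε.toRingHom).obj (ModuleCat.of K K)

/-- Right multiplication by `a`, an endomorphism of the left module `A`. -/
def rightMul (a : A) : A →ₗ[A] A := LinearMap.toSpanSingleton A A a

/-- The Gorenstein property in dimension `D` for an algebra `A` with augmentation `ε`:
`Ext^n_A(K, A) = 0` for `n ≠ D`, and `Ext^D_A(K, A)` is isomorphic to the trivial module `K` as a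
right `A`-module. Here `K` and `A` are left modules and the right `A`-module structure
of `Ext^n_A(K, A)` comes from the right multiplications of `A`. -/
def IsGorensteinOfDim (ε : A →ₐ[K] K) (D : ℕ) : Prop :=
  (∀ n : ℕ, n ≠ D →
    Subsingleton (Abelian.Ext.{u} (trivialModule ε) (ModuleCat.of A A) n)) ∧
  ∃ φ : Abelian.Ext.{u} (trivialModule ε) (ModuleCat.of A A) D ≃+ K,
    ∀ (e : Abelian.Ext.{u} (trivialModule ε) (ModuleCat.of A A) D) (a : A),
      φ (e.comp (Abelian.Ext.mk₀ (ModuleCat.ofHom (rightMul a))) (add_zero D)) = φ e * ε a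

end Homological

/-- The data `(E, R)` of a quadratic algebra on `q` generators: a subspace `R` of `E ⊗ E`, where
`E` is the vector space with basis `x^0, …, x^(q-1)`. -/
@[ext]
structure QuadraticData (K : Type u) [Field K] (q : ℕ) where
  /-- The space of relations. -/
  rel : Submodule K (FreeAlgebra K (Fin q))
  /-- The relations are homogeneous of degree two. -/
  rel_le : rel ≤ genSpace K q ^ 2

namespace QuadraticData

variable {K : Type u} [Field K] {q : ℕ} (P : QuadraticData K q)

/-- The quadratic algebra `A(E, R) = T(E) / (R)`. -/
abbrev Alg : Type u :=
  RingQuot (fun f g : FreeAlgebra K (Fin q) => f ∈ P.rel ∧ g = 0)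

/-- The canonical projection `T(E) → A(E, R)`. -/
def proj : FreeAlgebra K (Fin q) →ₐ[K] P.Alg :=
  RingQuot.mkAlgHom K (fun f g : FreeAlgebra K (Fin q) => f ∈ P.rel ∧ g = 0)

/-- The generators `x^i` of the quadratic algebra. -/
def gen (i : Fin q) : P.Alg := P.proj (FreeAlgebra.ι K i)

theorem lift_zero_eq_zero_of_mem {f : FreeAlgebra K (Fin q)} (hf : f ∈ P.rel) :
    FreeAlgebra.lift K (fun _ : Fin q => (0 : K)) f = 0 := by
  have hE : genSpace K q ≤
      LinearMap.ker (FreeAlgebra.lift K (fun _ : Fin q => (0 : K))).toLinearMap := by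
    rw [genSpace, Submodule.span_le]
    rintro _ ⟨i, rfl⟩
    simp
  have h2 : genSpace K q ^ 2 ≤
      LinearMap.ker (FreeAlgebra.lift K (fun _ : Fin q => (0 : K))).toLinearMap := by
    rw [pow_two, Submodule.mul_le]
    intro m hm n _
    have := hE hm
    simp only [LinearMap.mem_ker, AlgHom.toLinearMap_apply] at this ⊢
    rw [map_mul, this, zero_mul]
  exact h2 (P.rel_le hf)

/-- The augmentation of the quadratic algebra, which sends every generator to `0`. -/
def augmentation : P.Alg →ₐ[K] K :=
  RingQuot.liftAlgHom K ⟨FreeAlgebra.lift K (fun _ : Fin q => (0 : K)), by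
    rintro f g ⟨hf, rfl⟩
    rw [P.lift_zero_eq_zero_of_mem hf, map_zero]⟩

/-- The space `W_n ⊆ E ⊗ n`, the intersection of all `E ⊗ i ⊗ R ⊗ E ⊗ j` with `i + 2 + j = n`. It is
the dual of the degree `n` part of the quadratic dual algebra; `W_0 = K`, `W_1 = E`, `W_2 = R`. -/
def koszulSpace (n : ℕ) : Submodule K (FreeAlgebra K (Fin q)) :=
  genSpace K q ^ n ⊓
    ⨅ (i : ℕ) (j : ℕ) (_ : i + 2 + j = n), genSpace K q ^ i * P.rel * genSpace K q ^ j

theorem stripLeft_mem_koszulSpace (i : Fin q) (n : ℕ) (f : FreeAlgebra K (Fin q))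
    (hf : f ∈ P.koszulSpace (n + 1)) : stripLeft K q i f ∈ P.koszulSpace n := by
  obtain ⟨h1, h2⟩ := Submodule.mem_inf.1 hf
  refine Submodule.mem_inf.2 ⟨?_, ?_⟩
  · rw [pow_succ'] at h1
    exact stripLeft_mem_of_mem_genSpace_mul i _ h1
  · simp only [Submodule.mem_iInf] at h2 ⊢
    intro k j hkj
    have h := h2 (k + 1) j (by omega)
    rw [pow_succ', mul_assoc, mul_assoc] at h
    rw [mul_assoc]
    exact stripLeft_mem_of_mem_genSpace_mul i _ h

/-- The differential `A ⊗ W_(n+1) → A ⊗ W_n` of the Koszul complex of left `A`-modules, induced by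
`a ⊗ (v_0 ⊗ v_1 ⊗ … ⊗ v_n) ↦ a v_0 ⊗ (v_1 ⊗ … ⊗ v_n)`. -/
def koszulD (n : ℕ) : P.Alg ⊗[K] P.koszulSpace (n + 1) →ₗ[P.Alg] P.Alg ⊗[K] P.koszulSpace n :=
  ∑ i : Fin q, TensorProduct.AlgebraTensorModule.map (rightMul (P.gen i))
    ((stripLeft K q i).restrict (P.stripLeft_mem_koszulSpace i n))

/-- The quadratic algebra is Koszul: its Koszul complex is acyclic in positive degrees. -/
def IsKoszul : Prop :=
  ∀ n : ℕ, Function.Exact (P.koszulD (n + 1)) (P.koszulD n)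

/-- The Gorenstein property (in dimension `D`) of the quadratic algebra. -/
def IsGorenstein (D : ℕ) : Prop := IsGorensteinOfDim P.augmentation D

theorem ι_mul_ι_mem (i j : Fin q) :
    FreeAlgebra.ι K i * FreeAlgebra.ι K j ∈ genSpace K q ^ 2 := by
  rw [pow_two]
  exact Submodule.mul_mem_mul (Submodule.subset_span ⟨i, rfl⟩) (Submodule.subset_span ⟨j, rfl⟩)

/-- The quadratic algebra on `q` generators with the single relation
`∑ i j, B_ij x^i x^j = 0`, where `B_ij = B(e_i, e_j)` are the components of `B` in the
canonical basis. -/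
def ofBilin (B : LinearMap.BilinForm K (Fin q → K)) : QuadraticData K q where
  rel := Submodule.span K
    {∑ i : Fin q, ∑ j : Fin q, B (Pi.single i 1) (Pi.single j 1) •
      (FreeAlgebra.ι K i * FreeAlgebra.ι K j)}
  rel_le := by
    rw [Submodule.span_singleton_le_iff_mem]
    exact Submodule.sum_mem _ fun i _ => Submodule.sum_mem _ fun j _ =>
      Submodule.smul_mem _ _ (ι_mul_ι_mem i j)

end QuadraticData

end

/-! For an algebra A with one quadratic relation of matrix B, every left module M fits into a
complex 0 → A⊗M → A⊗E⊗M → A⊗M → M → 0, the bimodule resolution of A tensored with M. Its exactness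
in the middle expresses the presentation: letting the generators act by triangular operators on N ⊕
M requires only the linearised relation on the corners (`IsOneRelator.exact_resolution`). On the
left it follows from the grading and the invertibility of B (`IsOneRelator.resolutionD₂_injective`).
Hence all projective dimensions are at most 2.

For M = K this complex is the Koszul complex. Nonzero linear forms are right regular
(`IsOneRelator.eq_zero_of_mul_eq_zero`), which makes its last map injective and forces W_3 = 0. The
opposite algebra has the transposed relation, so the dual complex is again of this kind: Ext⁰(K, A)
and Ext¹(K, A) vanish, and Ext²(K, A) = A / ∑ x^i A = K.

Conversely, projective dimension 2 and minimality of the Koszul complex force W_3 = 0, so that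
Ext²(K, A) is a quotient of Hom(A⊗W_2, A). By minimality the dual of R = W_2 embeds in Ext² = K, and
Ext² ≠ 0, so R is a line spanned by some ∑ C_ij x^i x^j. As x^i kills Ext², it lies in the right
ideal generated by the forms ∑_l C_lj x^l; comparing linear parts shows that the columns of C span
K^q.

Congruent forms are related by a linear substitution of the generators. -/

noncomputable section

set_option linter.unusedSectionVars false

/-! ### One-relator algebras and the standard resolution of a module -/

section OneRelator

variable {K : Type u} [Field K] {q : ℕ} {A : Type u} [Ring A] [Algebra K A]

/-- The algebra `A` is presented by the generators `x i` and the single quadratic relation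
`∑ i j, B i j • x i * x j = 0`. -/
structure IsOneRelator (B : Matrix (Fin q) (Fin q) K) (x : Fin q → A) : Prop where
  rel : ∑ i, ∑ j, B i j • (x i * x j) = 0
  adjoin_eq_top : Algebra.adjoin K (Set.range x) = ⊤
  exists_lift : ∀ (C : Type u) [Ring C] [Algebra K C] (y : Fin q → C),
    ∑ i, ∑ j, B i j • (y i * y j) = 0 → ∃ f : A →ₐ[K] C, ∀ i, f (x i) = y i

section Resolution

variable (M : Type u) [AddCommGroup M] [Module K M] [Module A M] [IsScalarTower K A M]

/-- Right multiplication by `a` on the left factor of `A ⊗ M`. -/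
def tensorRightMul (a : A) : A ⊗[K] M →ₗ[A] A ⊗[K] M :=
  AlgebraTensorModule.map (rightMul a) LinearMap.id

/-- The action of `a` on the right factor of `A ⊗ M`. -/
def tensorLeftSMul (a : A) : A ⊗[K] M →ₗ[A] A ⊗[K] M :=
  AlgebraTensorModule.map LinearMap.id (Algebra.lsmul K K M a)

@[simp]
theorem tensorRightMul_tmul (a b : A) (m : M) :
    tensorRightMul M a (b ⊗ₜ[K] m) = (b * a) ⊗ₜ m := by
  simp [tensorRightMul, rightMul]

@[simp]
theorem tensorLeftSMul_tmul (a b : A) (m : M) :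
    tensorLeftSMul M a (b ⊗ₜ[K] m) = b ⊗ₜ (a • m) := by
  simp [tensorLeftSMul]

/-- The augmentation `A ⊗ M → M` of the standard resolution of `M`. -/
def resolutionAug : A ⊗[K] M →ₗ[A] M :=
  AlgebraTensorModule.lift
    { toFun := fun a => (Algebra.lsmul K K M a)
      map_add' := by intros; simp
      map_smul' := by intros; ext; simp }

@[simp]
theorem resolutionAug_tmul (a : A) (m : M) : resolutionAug M (a ⊗ₜ[K] m) = a • m := by
  simp [resolutionAug]

/-- The differential `A ⊗ E ⊗ M → A ⊗ M` of the standard resolution of `M`. -/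
def resolutionD₁ (x : Fin q → A) : (Fin q → A ⊗[K] M) →ₗ[A] A ⊗[K] M :=
  ∑ i, (tensorRightMul M (x i) - tensorLeftSMul M (x i)) ∘ₗ LinearMap.proj i

/-- The differential `A ⊗ R ⊗ M → A ⊗ E ⊗ M` of the standard resolution of `M`. -/
def resolutionD₂ (B : Matrix (Fin q) (Fin q) K) (x : Fin q → A) :
    A ⊗[K] M →ₗ[A] (Fin q → A ⊗[K] M) :=
  LinearMap.pi fun j => ∑ i, (B i j • tensorRightMul M (x i) + B j i • tensorLeftSMul M (x i))

theorem resolutionD₁_single (x : Fin q → A) (i : Fin q) (u : A ⊗[K] M) :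
    resolutionD₁ M x (Pi.single i u) = tensorRightMul M (x i) u - tensorLeftSMul M (x i) u := by
  simp only [resolutionD₁, LinearMap.sum_apply, LinearMap.comp_apply, LinearMap.proj_apply]
  rw [Finset.sum_eq_single i]
  · simp
  · intro j _ h
    rw [Pi.single_eq_of_ne h, map_zero]
  · simp

variable {M}
variable {B : Matrix (Fin q) (Fin q) K} {x : Fin q → A}

theorem resolutionAug_surjective : Function.Surjective (resolutionAug (K := K) (A := A) M) :=
  fun m => ⟨1 ⊗ₜ m, by simp⟩

/-- Exactness of the standard resolution at `A ⊗ M`. -/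
theorem IsOneRelator.exact_aug (h : IsOneRelator B x) :
    Function.Exact (resolutionD₁ (K := K) M x) (resolutionAug M) := by
  -- Modulo the image of the differential, the letters of `a` can be moved one at a time across the
  -- tensor sign.
  have key : ∀ a : A, ∀ m : M,
      a ⊗ₜ[K] m - 1 ⊗ₜ (a • m) ∈ LinearMap.range (resolutionD₁ (K := K) M x) := by
    intro a
    have ha : a ∈ Algebra.adjoin K (Set.range x) := by rw [h.adjoin_eq_top]; trivial
    induction ha using Algebra.adjoin_induction with
    | mem a ha =>
      obtain ⟨i, rfl⟩ := ha
      intro m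
      exact ⟨Pi.single i (1 ⊗ₜ m), by simp [resolutionD₁_single]⟩
    | algebraMap r =>
      intro m
      rw [Algebra.algebraMap_eq_smul_one, smul_tmul, smul_assoc, one_smul, sub_self]
      exact zero_mem _
    | add a b _ _ ha hb =>
      intro m
      convert add_mem (ha m) (hb m) using 1
      rw [add_tmul, add_smul, tmul_add]
      abel
    | mul a b _ _ ha hb =>
      intro m
      convert add_mem (Submodule.smul_mem _ a (hb m)) (ha (b • m)) using 1
      rw [smul_sub, smul_tmul', smul_tmul', smul_eq_mul, smul_eq_mul, mul_one, mul_smul]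
      abel
  intro u
  constructor
  · intro hu
    have h2 : ∀ u : A ⊗[K] M, u - 1 ⊗ₜ resolutionAug M u ∈
        LinearMap.range (resolutionD₁ (K := K) M x) := by
      intro u
      induction u using TensorProduct.induction_on with
      | zero => simp
      | tmul a m => simpa using key a m
      | add u v hu hv =>
        convert add_mem hu hv using 1
        rw [map_add, tmul_add]
        abel
    simpa [hu] using h2 u
  · rintro ⟨v, rfl⟩
    have : resolutionAug M ∘ₗ resolutionD₁ (K := K) M x = 0 := by
      refine LinearMap.pi_ext' fun i => ?_
      refine AlgebraTensorModule.curry_injective (LinearMap.ext fun a => LinearMap.ext fun m => ?_)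
      simp [resolutionD₁_single, mul_smul]
    exact LinearMap.congr_fun this v

/-- Exactness of the standard resolution at `A ⊗ E ⊗ M`. -/
theorem IsOneRelator.exact_resolution (h : IsOneRelator B x) :
    Function.Exact (resolutionD₂ (K := K) M B x) (resolutionD₁ M x) := by
  intro u
  constructor
  · intro hu
    -- On N × M, with N the cokernel of `resolutionD₂`, let x^i act by a triangular operator with
    -- corner `s i`. The corner of the relation is the class of `resolutionD₂ (1 ⊗ m)`, which is
    -- zero in N; hence A acts on N × M.
    let N := (Fin q → A ⊗[K] M) ⧸ LinearMap.range (resolutionD₂ (K := K) M B x)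
    let s : Fin q → M →ₗ[K] N := fun i =>
      ((LinearMap.range (resolutionD₂ (K := K) M B x)).mkQ.restrictScalars K) ∘ₗ
        LinearMap.single K (fun _ => A ⊗[K] M) i ∘ₗ TensorProduct.mk K A M 1
    have hs : ∀ i m, s i m = Submodule.Quotient.mk (Pi.single i (1 ⊗ₜ m)) := fun i m => rfl
    let ξ : Fin q → Module.End K (N × M) := fun i =>
      LinearMap.prod
        (Algebra.lsmul K K N (x i) ∘ₗ LinearMap.fst K N M + s i ∘ₗ LinearMap.snd K N M)
        (Algebra.lsmul K K M (x i) ∘ₗ LinearMap.snd K N M)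
    have hξ : ∀ i n m, ξ i (n, m) = (x i • n + s i m, x i • m) := fun i n m => rfl
    have hrelN : ∀ n : N, ∑ i, ∑ j, B i j • (x i • x j • n) = 0 := by
      intro n
      have := congrArg (· • n) h.rel
      simpa [Finset.sum_smul, mul_smul] using this
    have hrelM : ∀ n : M, ∑ i, ∑ j, B i j • (x i • x j • n) = 0 := by
      intro n
      have := congrArg (· • n) h.rel
      simpa [Finset.sum_smul, mul_smul] using this
    have hrelS : ∀ m : M, ∑ i, ∑ j, B i j • (x i • s j m + s i (x j • m)) = 0 := by
      intro m
      have h1 : (Submodule.Quotient.mk (resolutionD₂ (K := K) M B x (1 ⊗ₜ m)) : N) = 0 := by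
        rw [Submodule.Quotient.mk_eq_zero]
        exact ⟨_, rfl⟩
      rw [← h1]
      have h2 : resolutionD₂ (K := K) M B x (1 ⊗ₜ m) = ∑ i, ∑ j, B i j •
          (x i • (Pi.single j (1 ⊗ₜ m) : Fin q → A ⊗[K] M) + Pi.single i (1 ⊗ₜ (x j • m))) := by
        ext k
        simp only [resolutionD₂, LinearMap.pi_apply, LinearMap.sum_apply, LinearMap.add_apply,
          LinearMap.smul_apply, tensorRightMul_tmul, tensorLeftSMul_tmul, Finset.sum_apply,
          Pi.smul_apply, Pi.add_apply, smul_add, Finset.sum_add_distrib, one_mul]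
        congr 1
        · refine Finset.sum_congr rfl fun i _ => ?_
          rw [Finset.sum_eq_single k]
          · simp [smul_tmul']
          · intro j _ hj
            rw [Pi.single_eq_of_ne hj.symm, smul_zero, smul_zero]
          · simp
        · symm
          rw [Finset.sum_eq_single k]
          · exact Finset.sum_congr rfl fun j _ => by rw [Pi.single_eq_same]
          · intro i _ hi
            exact Finset.sum_eq_zero fun j _ => by rw [Pi.single_eq_of_ne hi.symm, smul_zero]
          · simp
      rw [h2]
      simp only [hs]
      change _ = (LinearMap.range (resolutionD₂ (K := K) M B x)).mkQ.restrictScalars K _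
      simp only [map_sum, map_smul, map_add]
      rfl
    obtain ⟨f, hf⟩ := h.exists_lift _ ξ (by
      refine LinearMap.ext fun ⟨n, m⟩ => ?_
      simp only [LinearMap.sum_apply, LinearMap.smul_apply, Module.End.mul_apply, hξ]
      have e : ∀ i j, B i j • (x i • (x j • n + s j m) + s i (x j • m), x i • x j • m) =
        (B i j • (x i • x j • n) + B i j • (x i • s j m + s i (x j • m)),
          B i j • (x i • x j • m)) := by
        intro i j
        rw [Prod.smul_mk, smul_add (x i), add_assoc, smul_add (B i j)]
      simp only [e]
      ext
      · simp only [Prod.fst_sum, Finset.sum_add_distrib]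
        rw [hrelN, hrelS]
        simp
      · simp only [Prod.snd_sum]
        rw [hrelM]
        simp)
    have hf1 : ∀ a : A, ∀ n : N, f a (n, 0) = (a • n, 0) := by
      intro a
      have ha : a ∈ Algebra.adjoin K (Set.range x) := by rw [h.adjoin_eq_top]; trivial
      induction ha using Algebra.adjoin_induction with
      | mem a ha =>
        obtain ⟨i, rfl⟩ := ha
        intro n
        rw [hf, hξ]
        simp
      | algebraMap r => intro n; simp
      | add a b _ _ ha hb => intro n; simp [ha, hb, add_smul]
      | mul a b _ _ ha hb => intro n; simp [ha, hb, mul_smul]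
    -- Ψ is the corner of the action of A. It satisfies Ψ ∘ d₁ = (projection onto N), so a cycle of
    -- d₁ has zero class in N.
    let Ψ : A ⊗[K] M →ₗ[K] N := TensorProduct.lift
      { toFun := fun a => LinearMap.fst K N M ∘ₗ f a ∘ₗ LinearMap.inr K N M
        map_add' := by intros; ext; simp
        map_smul' := by intros; ext; simp }
    have hΨ : ∀ a m, Ψ (a ⊗ₜ m) = (f a (0, m)).1 := fun a m => rfl
    have key : Ψ ∘ₗ (resolutionD₁ (K := K) M x).restrictScalars K =
        (LinearMap.range (resolutionD₂ (K := K) M B x)).mkQ.restrictScalars K := by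
      refine LinearMap.pi_ext' fun i => TensorProduct.ext' fun a m => ?_
      simp only [LinearMap.comp_apply, LinearMap.single_apply, LinearMap.restrictScalars_apply,
        resolutionD₁_single, map_sub, tensorRightMul_tmul, tensorLeftSMul_tmul, hΨ, map_mul,
        Module.End.mul_apply, hf, hξ, smul_zero, zero_add]
      rw [← Prod.fst_sub, ← map_sub, Prod.mk_sub_mk, sub_self, sub_zero, hf1, hs]
      change (LinearMap.range (resolutionD₂ (K := K) M B x)).mkQ (a • _) = _
      congr 1
      rw [← Pi.single_smul, smul_tmul', smul_eq_mul, mul_one]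
    have := LinearMap.congr_fun key u
    simp only [LinearMap.comp_apply, LinearMap.restrictScalars_apply, hu, map_zero] at this
    exact (Submodule.Quotient.mk_eq_zero _).1 this.symm
  · rintro ⟨v, rfl⟩
    have : resolutionD₁ M x ∘ₗ resolutionD₂ (K := K) M B x = 0 := by
      suffices h : ∀ a m, resolutionD₁ M x (resolutionD₂ (K := K) M B x (a ⊗ₜ m)) = 0 from
        AlgebraTensorModule.curry_injective (LinearMap.ext fun a => LinearMap.ext fun m => h a m)
      intro a m
      have h1 : ∑ i, ∑ j, B i j • (a * x i * x j) = 0 := by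
        simpa [Finset.mul_sum, mul_assoc] using congrArg (a * ·) h.rel
      have h2 : ∑ i, ∑ j, B i j • (x i • x j • m) = 0 := by
        simpa [Finset.sum_smul, mul_smul] using congrArg (· • m) h.rel
      simp only [LinearMap.comp_apply, resolutionD₁, resolutionD₂, LinearMap.sum_apply,
        LinearMap.proj_apply, LinearMap.pi_apply, LinearMap.add_apply, LinearMap.smul_apply,
        LinearMap.sub_apply, tensorRightMul_tmul, tensorLeftSMul_tmul]
      have e : ∀ j, tensorRightMul M (x j)
            (∑ i, (B i j • (a * x i) ⊗ₜ[K] m + B j i • a ⊗ₜ[K] (x i • m))) -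
          tensorLeftSMul M (x j)
            (∑ i, (B i j • (a * x i) ⊗ₜ[K] m + B j i • a ⊗ₜ[K] (x i • m))) =
          ∑ i, (B i j • (a * x i * x j)) ⊗ₜ m + ∑ i, B j i • (a * x j) ⊗ₜ[K] (x i • m)
          - (∑ i, B i j • (a * x i) ⊗ₜ[K] (x j • m) + ∑ i, a ⊗ₜ (B j i • (x j • x i • m))) := by
        intro j
        simp only [map_sum, map_add, tensorRightMul_tmul,
          tensorLeftSMul_tmul, Finset.sum_add_distrib, smul_tmul', tmul_smul,
          smul_mul_assoc]
      refine (Finset.sum_congr rfl fun j _ => e j).trans ?_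
      rw [Finset.sum_sub_distrib, Finset.sum_add_distrib, Finset.sum_add_distrib,
        Finset.sum_comm (f := fun j i => (B i j • (a * x i * x j)) ⊗ₜ[K] m),
        Finset.sum_comm (f := fun j i => B i j • (a * x i) ⊗ₜ[K] (x j • m))]
      simp only [← sum_tmul, ← tmul_sum]
      rw [h1, h2]
      simp
    exact LinearMap.congr_fun this v

end Resolution

end OneRelator

/-! ### Grading, regularity of linear forms, injectivity on the left -/

section OneRelator

variable {K : Type u} [Field K] {q : ℕ} {A : Type u} [Ring A] [Algebra K A]
variable {B : Matrix (Fin q) (Fin q) K} {x : Fin q → A}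

/-- The opposite of a one relator algebra has the transposed relation. -/
theorem IsOneRelator.op (h : IsOneRelator B x) :
    IsOneRelator B.transpose (fun i => MulOpposite.op (x i)) where
  rel := by
    have := congrArg MulOpposite.op h.rel
    rw [Finset.sum_comm] at this
    simpa [Finset.op_sum, Matrix.transpose_apply] using this
  adjoin_eq_top := by
    have : Set.range (fun i => MulOpposite.op (x i)) = MulOpposite.unop ⁻¹' Set.range x := by
      ext a
      simp only [Set.mem_range, Set.mem_preimage]
      exact exists_congr fun i => ⟨fun hi => by rw [← hi, MulOpposite.unop_op],
        fun hi => by rw [hi, MulOpposite.op_unop]⟩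
    rw [this, ← Subalgebra.op_adjoin, h.adjoin_eq_top, Subalgebra.op_top]
  exists_lift C _ _ y hy := by
    obtain ⟨f, hf⟩ := h.exists_lift Cᵐᵒᵖ (fun i => MulOpposite.op (y i)) (by
      have := congrArg MulOpposite.op hy
      rw [Finset.sum_comm] at this
      simpa [Finset.op_sum, Matrix.transpose_apply] using this)
    exact ⟨AlgHom.opComm f, fun i => by simp [AlgHom.opComm, hf]⟩

/-- The homogeneous components of the elements of a one relator algebra. -/
theorem IsOneRelator.exists_components (h : IsOneRelator B x) :
    ∃ π : ℕ → A →ₗ[K] A, (∀ n i a, π (n + 1) (a * x i) = π n a * x i) ∧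
      (∀ i a, π 0 (a * x i) = 0) ∧
      ∀ a, ∀ᶠ n in Filter.atTop, π n a = 0 ∧ ∑ k ∈ Finset.range n, π k a = a := by
  -- The relation is homogeneous, so x^i ↦ x^i T extends to A → A[T]. The coefficient of T^n is the
  -- component of degree n, and T ↦ 1 recovers the element.
  obtain ⟨f, hf⟩ := h.exists_lift (Polynomial A) (fun i => Polynomial.monomial 1 (x i)) (by
    have := congrArg (Polynomial.monomial 2) h.rel
    simp only [map_sum, map_zero] at this
    simp only [Polynomial.monomial_mul_monomial, Polynomial.smul_monomial]
    exact this)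
  let ev : Polynomial A →ₐ[K] A :=
    { Polynomial.eval₂RingHom' (RingHom.id A) 1 (fun a => Commute.one_right _) with
      commutes' := fun r => Polynomial.eval₂_C _ _ }
  have hevp : ∀ p, ev p = p.eval₂ (RingHom.id A) 1 := fun p => rfl
  have hev : ev.comp f = AlgHom.id K A := by
    refine AlgHom.ext_of_adjoin_eq_top h.adjoin_eq_top ?_
    rintro _ ⟨i, rfl⟩
    simp [hf, hevp]
  refine ⟨fun n => ((Polynomial.lcoeff A n).restrictScalars K) ∘ₗ f.toLinearMap, ?_, ?_, ?_⟩
  · intro n i a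
    simp [hf, Polynomial.coeff_mul_monomial]
  · intro i a
    simp [hf, Polynomial.mul_coeff_zero]
  · intro a
    filter_upwards [Filter.eventually_ge_atTop ((f a).natDegree + 1)] with n hn
    refine ⟨?_, ?_⟩
    · simpa using Polynomial.coeff_eq_zero_of_natDegree_lt (show (f a).natDegree < n by omega)
    · have := AlgHom.congr_fun hev a
      simp only [AlgHom.comp_apply, hevp, AlgHom.id_apply] at this
      rw [Polynomial.eval₂_eq_sum_range' _ (show (f a).natDegree < n by omega)] at this
      simpa using this

/-- The only relations between the generators, as elements of a left module, are the multiples of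
the relation of the algebra. -/
theorem IsOneRelator.exists_of_sum_eq_zero (h : IsOneRelator B x) {a : Fin q → A}
    (ha : ∑ i, a i * x i = 0) : ∃ g : A, ∀ j, a j = ∑ i, B i j • (g * x i) := by
  -- The standard resolution is taken for M = K with all generators acting by zero, so only the
  -- right multiplications survive in its differentials.
  obtain ⟨ε, hε⟩ := h.exists_lift K (fun _ => 0) (by simp)
  let _ : Module A K := Module.compHom K ε.toRingHom
  have hsmul : ∀ (a : A) (k : K), a • k = ε a * k := fun _ _ => rfl
  have : IsScalarTower K A K := ⟨fun c a k => by simp [hsmul, mul_assoc]⟩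
  have h0 : ∀ (i : Fin q) (u : A ⊗[K] K), tensorLeftSMul K (x i) u = 0 := by
    intro i u
    induction u using TensorProduct.induction_on with
    | zero => simp
    | tmul a k => simp [hsmul, hε]
    | add u v hu hv => rw [map_add, hu, hv, add_zero]
  have h1 : resolutionD₁ (K := K) K x (fun i => a i ⊗ₜ 1) = 0 := by
    simp only [resolutionD₁, LinearMap.sum_apply, LinearMap.comp_apply, LinearMap.proj_apply,
      LinearMap.sub_apply, h0, sub_zero, tensorRightMul_tmul]
    rw [← sum_tmul, ha, zero_tmul]
  obtain ⟨w, hw⟩ := (h.exact_resolution (M := K) _).1 h1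
  have hw' : w = TensorProduct.rid K A w ⊗ₜ 1 := by
    rw [← TensorProduct.rid_symm_apply, LinearEquiv.symm_apply_apply]
  refine ⟨TensorProduct.rid K A w, fun j => ?_⟩
  have := congrArg (TensorProduct.rid K A) (congrFun hw j)
  rw [TensorProduct.rid_tmul, one_smul] at this
  rw [← this, hw']
  simp [resolutionD₂, h0]

/-- The place where `2 ≤ q` is needed: a linear form in at least two variables has a nontrivial
zero. -/
theorem exists_ne_zero_sum_mul_eq_zero (hq : 2 ≤ q) (v : Fin q → K) :
    ∃ c : Fin q → K, c ≠ 0 ∧ ∑ i, c i * v i = 0 := by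
  let f : (Fin q → K) →ₗ[K] K := ∑ i, v i • LinearMap.proj i
  have : LinearMap.ker f ≠ ⊥ := LinearMap.ker_ne_bot_of_finrank_lt (by simp; omega)
  obtain ⟨c, hc, hc0⟩ := Submodule.exists_mem_ne_zero_of_ne_bot this
  refine ⟨c, hc0, ?_⟩
  simpa [f, mul_comm] using hc

/-- A nonzero linear combination of the generators is right regular. -/
theorem IsOneRelator.eq_zero_of_mul_eq_zero (hq : 2 ≤ q) (hB : IsUnit B.det)
    (h : IsOneRelator B x) {a : A} {v : Fin q → K} (hv : v ≠ 0) (hav : ∑ i, v i • (a * x i) = 0) :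
    a = 0 := by
  obtain ⟨π, hπ, hπ0, hπs⟩ := h.exists_components
  suffices H : ∀ n, ∀ a : A, ∀ v : Fin q → K, v ≠ 0 → ∑ i, v i • (a * x i) = 0 → π n a = 0 by
    obtain ⟨n, -, hn⟩ := (hπs a).exists
    rw [← hn]
    exact Finset.sum_eq_zero fun k _ => H k a v hv hav
  -- Descent. The family (v_i a) is a syzygy of the generators, hence v_j a = g ∑_i B_ij x^i for all
  -- j. An index with v_j ≠ 0 writes `a` as g times a linear form; a vector c ≠ 0 orthogonal to v
  -- shows that g is killed by the form with coefficients B c ≠ 0.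
  have step : ∀ a : A, ∀ v : Fin q → K, v ≠ 0 → ∑ i, v i • (a * x i) = 0 →
      ∃ g : A, ∃ c d : Fin q → K, d ≠ 0 ∧ ∑ i, d i • (g * x i) = 0 ∧
        a = ∑ i, c i • (g * x i) := by
    intro a v hv hav
    obtain ⟨g, hg⟩ := h.exists_of_sum_eq_zero (a := fun i => v i • a) (by simpa using hav)
    obtain ⟨j, hj⟩ := Function.ne_iff.1 hv
    obtain ⟨c, hc0, hc⟩ := exists_ne_zero_sum_mul_eq_zero hq v
    refine ⟨g, fun i => (v j)⁻¹ * B i j, B.mulVec c, ?_, ?_, ?_⟩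
    · intro h0
      exact hc0 (Matrix.eq_zero_of_mulVec_eq_zero hB.ne_zero h0)
    · have : ∑ j, c j • (v j • a) = 0 := by
        simp only [smul_smul]
        rw [← Finset.sum_smul, hc, zero_smul]
      simp only [hg] at this
      rw [← this]
      simp only [Matrix.mulVec, dotProduct, Finset.sum_smul, Finset.smul_sum, smul_smul]
      rw [Finset.sum_comm]
      simp only [mul_comm]
    · simp only [mul_smul]
      rw [← Finset.smul_sum, ← hg j, inv_smul_smul₀ hj]
  intro n
  -- The component of degree n + 1 of `a` is that of degree n of g times a linear form, and g
  -- satisfies the same hypothesis as `a`.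
  induction n with
  | zero =>
    intro a v hv hav
    obtain ⟨g, c, d, -, -, rfl⟩ := step a v hv hav
    simp [hπ0]
  | succ n ih =>
    intro a v hv hav
    obtain ⟨g, c, d, hd, hgd, rfl⟩ := step a v hv hav
    simp [hπ, ih g d hd hgd]

theorem IsOneRelator.eq_zero_of_mul_gen_eq_zero (hq : 2 ≤ q) (hB : IsUnit B.det)
    (h : IsOneRelator B x) {a : A} (i : Fin q) (ha : a * x i = 0) : a = 0 := by
  refine h.eq_zero_of_mul_eq_zero hq hB (v := Pi.single i 1) (by simp) ?_
  rw [Finset.sum_eq_single i]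
  · simp [ha]
  · intro j _ hj
    rw [Pi.single_eq_of_ne hj, zero_smul]
  · simp

section Resolution

variable {M : Type u} [AddCommGroup M] [Module K M] [Module A M] [IsScalarTower K A M]

theorem IsOneRelator.tensorRightMul_injective (hq : 2 ≤ q) (hB : IsUnit B.det)
    (h : IsOneRelator B x) (i : Fin q) :
    Function.Injective (tensorRightMul (K := K) M (x i)) := by
  have hi : Function.Injective ((rightMul (x i)).restrictScalars K) := by
    rw [injective_iff_map_eq_zero]
    intro a ha
    exact h.eq_zero_of_mul_gen_eq_zero hq hB i (by simpa [rightMul] using ha)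
  have e : (tensorRightMul (K := K) M (x i)).restrictScalars K =
      ((rightMul (x i)).restrictScalars K).rTensor M :=
    TensorProduct.ext' fun a m => by simp [rightMul]
  have := Module.Flat.rTensor_preserves_injective_linearMap (M := M) _ hi
  rw [← e] at this
  exact this

/-- Exactness of the standard resolution at `A ⊗ R ⊗ M`. -/
theorem IsOneRelator.resolutionD₂_injective (hq : 2 ≤ q) (hB : IsUnit B.det)
    (h : IsOneRelator B x) : Function.Injective (resolutionD₂ (K := K) M B x) := by
  obtain ⟨π, hπ, hπ0, hπs⟩ := h.exists_components
  let i₀ : Fin q := ⟨0, by omega⟩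
  let Pt : ℕ → A ⊗[K] M →ₗ[K] A ⊗[K] M := fun n => (π n).rTensor M
  have hinj := h.tensorRightMul_injective (M := M) hq hB i₀
  have hPtr : ∀ n u, Pt (n + 1) (tensorRightMul M (x i₀) u) = tensorRightMul M (x i₀) (Pt n u) := by
    intro n u
    induction u using TensorProduct.induction_on with
    | zero => simp
    | tmul a m => simp [Pt, hπ]
    | add u v hu hv => simp only [map_add, hu, hv]
  have hPtl : ∀ n a u, Pt n (tensorLeftSMul M a u) = tensorLeftSMul M a (Pt n u) := by
    intro n a u
    induction u using TensorProduct.induction_on with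
    | zero => simp
    | tmul a m => simp [Pt]
    | add u v hu hv => simp only [map_add, hu, hv]
  have hPts : ∀ u, ∀ᶠ n in Filter.atTop, Pt n u = 0 ∧ ∑ k ∈ Finset.range n, Pt k u = u := by
    intro u
    induction u using TensorProduct.induction_on with
    | zero => simp
    | tmul a m =>
      filter_upwards [hπs a] with n hn
      simp only [Pt, LinearMap.rTensor_tmul]
      rw [← sum_tmul, hn.1, hn.2]
      simp
    | add u v hu hv =>
      filter_upwards [hu, hv] with n hun hvn
      simp only [map_add, Finset.sum_add_distrib]
      rw [hun.1, hun.2, hvn.1, hvn.2]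
      simp
  rw [injective_iff_map_eq_zero]
  intro u hu
  have hj : ∀ j, ∑ i, B i j • tensorRightMul M (x i) u =
      -∑ i, tensorLeftSMul M (x i) (B j i • u) := by
    intro j
    have := congrFun hu j
    simp only [resolutionD₂, LinearMap.pi_apply, LinearMap.sum_apply, LinearMap.add_apply,
      LinearMap.smul_apply, Finset.sum_add_distrib, Pi.zero_apply] at this
    rw [eq_neg_of_add_eq_zero_left this]
    simp only [LinearMap.map_smul_of_tower]
  -- Inverting B expresses right multiplication by one generator through operators on M, which
  -- preserve the degree in A.
  have h0 : tensorRightMul M (x i₀) u =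
      -∑ j, ∑ i, tensorLeftSMul M (x i) (B⁻¹ j i₀ • B j i • u) := by
    have e : ∑ j, B⁻¹ j i₀ • ∑ i, B i j • tensorRightMul M (x i) u =
        tensorRightMul M (x i₀) u := by
      simp only [Finset.smul_sum, smul_smul]
      rw [Finset.sum_comm]
      simp only [← Finset.sum_smul]
      have : ∀ i, ∑ j, B⁻¹ j i₀ * B i j = (1 : Matrix (Fin q) (Fin q) K) i i₀ := by
        intro i
        rw [← Matrix.mul_nonsing_inv B hB, Matrix.mul_apply]
        simp only [mul_comm]
      simp only [this, Matrix.one_apply, ite_smul, one_smul, zero_smul]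
      simp
    rw [← e]
    simp only [hj]
    simp only [smul_neg, Finset.sum_neg_distrib, Finset.smul_sum, LinearMap.map_smul_of_tower]
  -- Right multiplication raises the degree by one, so degree n of u is controlled by degree n + 1.
  -- High components vanish, and vanishing descends to all degrees.
  have hstep : ∀ n, Pt (n + 1) u = 0 → Pt n u = 0 := by
    intro n hn
    apply hinj
    rw [← hPtr, h0]
    simp only [map_neg, map_sum, hPtl, map_smul, hn]
    simp
  obtain ⟨n, hn, hsum⟩ := (hPts u).exists
  rw [← hsum]
  refine Finset.sum_eq_zero fun k hk => ?_
  exact Nat.decreasingInduction (motive := fun k _ => Pt k u = 0) (fun k _ hk => hstep k hk) hn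
    (Finset.mem_range.1 hk).le

end Resolution

/-- The second differential of the Koszul complex, in the form of the dual complex. -/
theorem IsOneRelator.exists_of_sum_smul_eq_zero (h : IsOneRelator B x) (hB : IsUnit B.det)
    {c : Fin q → A} (hc : ∑ i, ∑ j, B i j • (x i * c j) = 0) : ∃ g : A, ∀ j, c j = x j * g := by
  -- Over the opposite algebra the hypothesis is a syzygy of the generators with coefficients ∑_j
  -- B_ij c_j; inverting B then isolates each c_j.
  obtain ⟨g, hg⟩ := h.op.exists_of_sum_eq_zero
    (a := fun i => MulOpposite.op (∑ j, B i j • c j)) (by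
      have := congrArg MulOpposite.op hc
      simpa [Finset.op_sum, Finset.mul_sum, Finset.sum_mul] using this)
  refine ⟨g.unop, fun j => ?_⟩
  have hg' : ∀ i, ∑ j, B i j • c j = ∑ j, B i j • (x j * g.unop) := by
    intro i
    have := congrArg MulOpposite.unop (hg i)
    simpa [Finset.unop_sum, Matrix.transpose_apply] using this
  have e : ∀ w : Fin q → A, w j = ∑ i, B⁻¹ j i • ∑ k, B i k • w k := by
    intro w
    simp only [Finset.smul_sum, smul_smul]
    rw [Finset.sum_comm]
    simp only [← Finset.sum_smul, ← Matrix.mul_apply, Matrix.nonsing_inv_mul B hB,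
      Matrix.one_apply, ite_smul, one_smul, zero_smul]
    simp
  rw [e c, e (fun j => x j * g.unop)]
  simp only [hg']

theorem IsOneRelator.eq_zero_of_gen_mul_eq_zero (hq : 2 ≤ q) (hB : IsUnit B.det)
    (h : IsOneRelator B x) {a : A} (i : Fin q) (ha : x i * a = 0) : a = 0 := by
  have := h.op.eq_zero_of_mul_gen_eq_zero hq (by rwa [Matrix.det_transpose])
    (a := MulOpposite.op a) i (by rw [← MulOpposite.op_mul, ha, MulOpposite.op_zero])
  simpa using this

end OneRelator

/-! ### Ext¹ and Ext² from two spliced short exact sequences -/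

section ExtTwo

open Abelian

universe v w

variable {C : Type u} [Category.{v} C] [Abelian C] [HasExt.{w} C] {F₂ F₁ Z F₀ M : C}
  {f : F₂ ⟶ F₁} {g : F₁ ⟶ Z} {i : Z ⟶ F₀} {p : F₀ ⟶ M} {w₁ : f ≫ g = 0} {w₀ : i ≫ p = 0}
  (h₁ : (ShortComplex.mk f g w₁).ShortExact) (h₀ : (ShortComplex.mk i p w₀).ShortExact) (Y : C)

/-- The connecting map from `Hom(F₂, Y)` to `Ext²(M, Y)` for short exact sequences
`0 → F₂ → F₁ → Z → 0` and `0 → Z → F₀ → M → 0`. -/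
def toExtTwo : (F₂ ⟶ Y) →+ Ext.{w} M Y 2 :=
  (h₀.extClass.precomp Y (show 1 + 1 = 2 from rfl)).comp
    ((h₁.extClass.precomp Y (add_zero 1)).comp Ext.addEquiv₀.symm.toAddMonoidHom)

theorem toExtTwo_apply (h : F₂ ⟶ Y) : toExtTwo h₁ h₀ Y h =
    h₀.extClass.comp (h₁.extClass.comp (Ext.mk₀ h) (add_zero 1)) (show 1 + 1 = 2 from rfl) :=
  rfl

variable {Y} in
theorem toExtTwo_comp {Y' : C} (h : F₂ ⟶ Y) (r : Y ⟶ Y') :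
    (toExtTwo h₁ h₀ Y h).comp (Ext.mk₀ r) (add_zero 2) = toExtTwo h₁ h₀ Y' (h ≫ r) := by
  rw [toExtTwo_apply, toExtTwo_apply, Ext.comp_assoc_of_third_deg_zero,
    Ext.comp_assoc_of_third_deg_zero, Ext.mk₀_comp_mk₀]

/-- The obstructions to lifting through the two connecting maps lie in Ext²(F₀, Y) and Ext¹(F₁, Y),
which vanish. -/
theorem toExtTwo_surjective [Projective F₁] [Projective F₀] :
    Function.Surjective (toExtTwo h₁ h₀ Y) := by
  intro e
  obtain ⟨e₁, rfl⟩ := Ext.contravariant_sequence_exact₃ h₀ Y e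
    (Ext.eq_zero_of_projective (P := F₀) _) (n₀ := 1) rfl
  obtain ⟨e₂, rfl⟩ := Ext.contravariant_sequence_exact₃ h₁ Y e₁
    (Ext.eq_zero_of_projective (P := F₁) _) (n₀ := 0) rfl
  obtain ⟨f, rfl⟩ := Ext.addEquiv₀.symm.surjective e₂
  exact ⟨f, rfl⟩

/-- As Ext¹(F₀, Y) = 0, the second connecting map is injective, so the kernel is that of the first:
the maps extending to F₁. -/
theorem toExtTwo_eq_zero_iff [Projective F₀] (h : F₂ ⟶ Y) :
    toExtTwo h₁ h₀ Y h = 0 ↔ ∃ k : F₁ ⟶ Y, f ≫ k = h := by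
  constructor
  · intro hh
    rw [toExtTwo_apply] at hh
    obtain ⟨e₁, he₁⟩ := Ext.contravariant_sequence_exact₁ h₀ Y _ rfl hh
    rw [Ext.eq_zero_of_projective (P := F₀) e₁, Ext.comp_zero] at he₁
    obtain ⟨e₂, he₂⟩ := Ext.contravariant_sequence_exact₁ h₁ Y _ rfl he₁.symm
    obtain ⟨k, rfl⟩ := Ext.addEquiv₀.symm.surjective e₂
    refine ⟨k, (Ext.mk₀_bijective _ _).1 ?_⟩
    rw [← Ext.mk₀_comp_mk₀]
    exact he₂
  · rintro ⟨k, rfl⟩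
    rw [toExtTwo_apply, ← Ext.mk₀_comp_mk₀]
    erw [h₁.extClass_comp_assoc]
    rw [Ext.comp_zero]

-- A class in Ext¹ comes from a map Z → Y. Pulled back to F₁ it is a cocycle, hence by `H` a
-- coboundary, so the map extends to F₀ and its class is zero.
include w₁ h₀ in
theorem subsingleton_ext_one [Projective F₀] [Epi g]
    (H : ∀ k : F₁ ⟶ Y, f ≫ k = 0 → ∃ l : F₀ ⟶ Y, g ≫ i ≫ l = k) :
    Subsingleton (Ext.{w} M Y 1) := by
  refine subsingleton_of_forall_eq 0 fun e => ?_
  obtain ⟨e₁, rfl⟩ := Ext.contravariant_sequence_exact₃ h₀ Y e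
    (Ext.eq_zero_of_projective (P := F₀) _) (n₀ := 0) rfl
  obtain ⟨k, rfl⟩ := Ext.addEquiv₀.symm.surjective e₁
  obtain ⟨l, hl⟩ := H (g ≫ k) (by rw [reassoc_of% w₁, Limits.zero_comp])
  rw [cancel_epi] at hl
  subst hl
  change h₀.extClass.comp (Ext.mk₀ (i ≫ l)) _ = 0
  rw [← Ext.mk₀_comp_mk₀]
  exact h₀.extClass_comp_assoc _

end ExtTwo

/-! ### Projective dimension and resolutions of length two -/

section LengthTwoResolution

variable {A : Type u} [Ring A] {F₂ F₁ F₀ : Type u} [AddCommGroup F₂] [AddCommGroup F₁]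
  [AddCommGroup F₀] [Module A F₂] [Module A F₁] [Module A F₀] {M : ModuleCat.{u} A}
  {d₂ : F₂ →ₗ[A] F₁} {d₁ : F₁ →ₗ[A] F₀} {d₀ : F₀ →ₗ[A] M}

theorem moduleCat_shortExact {X Y Z : ModuleCat.{u} A} {f : X ⟶ Y} {g : Y ⟶ Z} (w : f ≫ g = 0)
    (hf : Function.Injective f) (hfg : Function.Exact f g) (hg : Function.Surjective g) :
    (ShortComplex.mk f g w).ShortExact where
  exact := (ShortComplex.ShortExact.moduleCat_exact_iff_function_exact _).2 hfg
  mono_f := (ModuleCat.mono_iff_injective _).2 hf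
  epi_g := (ModuleCat.epi_iff_surjective _).2 hg

/-- The left part `F₂ → F₁ → im d₁` of an exact sequence `F₂ → F₁ → F₀`. -/
def leftPart (h₁ : Function.Exact d₂ d₁) : ShortComplex (ModuleCat.{u} A) :=
  ShortComplex.mk (ModuleCat.ofHom d₂) (ModuleCat.ofHom d₁.rangeRestrict) (by
    ext y
    exact h₁.apply_apply_eq_zero y)

/-- The right part `im d₁ → F₀ → M` of an exact sequence `F₁ → F₀ → M`. -/
def rightPart (h₀ : Function.Exact d₁ d₀) : ShortComplex (ModuleCat.{u} A) :=
  ShortComplex.mk (X₃ := M) (ModuleCat.ofHom (LinearMap.range d₁).subtype) (ModuleCat.ofHom d₀) (by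
    ext ⟨_, y, rfl⟩
    exact h₀.apply_apply_eq_zero y)

theorem leftPart_shortExact (h₂ : Function.Injective d₂) (h₁ : Function.Exact d₂ d₁) :
    (leftPart h₁).ShortExact :=
  moduleCat_shortExact _ h₂
    (fun y => Iff.trans Subtype.ext_iff (h₁ y)) d₁.surjective_rangeRestrict

theorem rightPart_shortExact (h₀ : Function.Exact d₁ d₀) (hs : Function.Surjective d₀) :
    (rightPart h₀).ShortExact :=
  moduleCat_shortExact _ Subtype.val_injective
    (fun y => by
      refine (h₀ y).trans ?_
      simp) hs

theorem hasProjectiveDimensionLT_three [Module.Projective A F₂] [Module.Projective A F₁]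
    [Module.Projective A F₀] (h₂ : Function.Injective d₂) (h₁ : Function.Exact d₂ d₁)
    (h₀ : Function.Exact d₁ d₀) (hs : Function.Surjective d₀) :
    HasProjectiveDimensionLT M 3 := by
  have p : ∀ F : Type u, ∀ [AddCommGroup F] [Module A F] [Module.Projective A F] (n : ℕ),
      HasProjectiveDimensionLT (ModuleCat.of A F) (n + 1) := fun F _ _ _ n => by
    have : Projective (ModuleCat.of A F) := (IsProjective.iff_projective F).1 inferInstance
    exact hasProjectiveDimensionLT_of_ge _ 1 _ (by omega)
  have z : HasProjectiveDimensionLT (rightPart h₀).X₁ 2 :=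
    (leftPart_shortExact h₂ h₁).hasProjectiveDimensionLT_X₃ 1 (p F₂ 0) (p F₁ 1)
  exact (rightPart_shortExact h₀ hs).hasProjectiveDimensionLT_X₃ 2 z (p F₀ 2)

/-- If `M` has projective dimension at most `2`, then the image of `d₂` is a direct summand: there
is an endomorphism of `F₂` which is a projection onto the kernel of `d₂`. -/
theorem exists_projection_ker [Module.Projective A F₁] [Module.Projective A F₀]
    [HasProjectiveDimensionLT M 3] (h₁ : Function.Exact d₂ d₁) (h₀ : Function.Exact d₁ d₀)
    (hs : Function.Surjective d₀) :
    ∃ p : F₂ →ₗ[A] F₂, (∀ y, d₂ (p y) = 0) ∧ ∀ y, d₂ y = 0 → p y = y := by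
  have p : ∀ F : Type u, ∀ [AddCommGroup F] [Module A F] [Module.Projective A F] (n : ℕ),
      HasProjectiveDimensionLT (ModuleCat.of A F) (n + 1) := fun F _ _ _ n => by
    have : Projective (ModuleCat.of A F) := (IsProjective.iff_projective F).1 inferInstance
    exact hasProjectiveDimensionLT_of_ge _ 1 _ (by omega)
  -- Shifting dimensions twice makes the kernel of d₁ projective, so the surjection F₂ → ker d₁
  -- splits.
  have z : HasProjectiveDimensionLT (rightPart h₀).X₁ 2 :=
    (rightPart_shortExact h₀ hs).hasProjectiveDimensionLT_X₁ 2 (p F₀ 1) ‹_›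
  have hk : Function.Exact (LinearMap.ker d₁).subtype d₁ := fun y => by simp
  have z' : HasProjectiveDimensionLT (leftPart hk).X₁ 1 :=
    (leftPart_shortExact Subtype.val_injective hk).hasProjectiveDimensionLT_X₁ 1 (p F₁ 0) z
  have z'' : Projective (ModuleCat.of A (LinearMap.ker d₁)) :=
    projective_iff_hasProjectiveDimensionLT_one.2 z'
  have z3 : Module.Projective A (LinearMap.ker d₁) := (IsProjective.iff_projective _).2 z''
  let e : F₂ →ₗ[A] LinearMap.ker d₁ := d₂.codRestrict _ h₁.apply_apply_eq_zero
  have he : Function.Surjective e := by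
    rintro ⟨y, hy⟩
    obtain ⟨w, hw⟩ := (h₁ y).1 hy
    exact ⟨w, Subtype.ext hw⟩
  obtain ⟨s, hs⟩ := Module.projective_lifting_property e LinearMap.id he
  have hes : ∀ y, e (s y) = y := LinearMap.congr_fun hs
  refine ⟨LinearMap.id - s ∘ₗ e, fun y => ?_, fun y hy => ?_⟩
  · have := congrArg Subtype.val (hes (e y))
    have h2 : d₂ (s (e y)) = d₂ y := this
    simp [h2]
  · have : e y = 0 := Subtype.ext hy
    simp [this]

end LengthTwoResolution

/-! ### Global dimension at most two -/

section OneRelator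

variable {K : Type u} [Field K] {q : ℕ} {A : Type u} [Ring A] [Algebra K A]
variable {B : Matrix (Fin q) (Fin q) K} {x : Fin q → A}

/-- Over the field K every M is free, so A ⊗ M is free over A and the standard resolution is
projective for every module M. -/
theorem IsOneRelator.hasProjectiveDimensionLT_three (hq : 2 ≤ q) (hB : IsUnit B.det)
    (h : IsOneRelator B x) (M : ModuleCat.{u} A) : HasProjectiveDimensionLT M 3 := by
  let _ : Module K M := Module.compHom M (algebraMap K A)
  have : IsScalarTower K A M := ⟨fun c a m => by
    change (c • a) • m = algebraMap K A c • a • m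
    rw [Algebra.smul_def, mul_smul]⟩
  exact _root_.hasProjectiveDimensionLT_three (h.resolutionD₂_injective (M := M) hq hB)
    h.exact_resolution h.exact_aug resolutionAug_surjective

end OneRelator

/-! ### The trivial module and the augmentation ideal -/

section TrivialModule

variable {K : Type u} [Field K] {A : Type u} [Ring A] [Algebra K A] (ε : A →ₐ[K] K)

theorem trivialModule_smul (a : A) (k : trivialModule ε) :
    a • k = (show trivialModule ε from ε a * (show K from k)) :=
  rfl

/-- The augmentation as a homomorphism of left modules. -/
def trivialModuleAug : A →ₗ[A] trivialModule ε where
  toFun a := (show trivialModule ε from ε a)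
  map_add' a b := map_add ε a b
  map_smul' a b := map_mul ε a b

theorem trivialModuleAug_eq_zero_iff (a : A) : trivialModuleAug ε a = 0 ↔ ε a = 0 :=
  Iff.rfl

theorem trivialModuleAug_surjective : Function.Surjective (trivialModuleAug ε) := fun k =>
  ⟨algebraMap K A (show K from k), ε.commutes _⟩

variable {ε} {ι : Type*} [Fintype ι] {x : ι → A}

/-- This left version gives exactness of the Koszul complex at A ⊗ W_0; the right version below
identifies the quotient of A that computes Ext². -/
theorem exists_eq_aug_add_sum_mul (hx : Algebra.adjoin K (Set.range x) = ⊤)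
    (hε : ∀ i, ε (x i) = 0) (a : A) :
    ∃ c : ι → A, a = algebraMap K A (ε a) + ∑ i, c i * x i := by
  classical
  have ha : a ∈ Algebra.adjoin K (Set.range x) := by rw [hx]; trivial
  induction ha using Algebra.adjoin_induction with
  | mem a ha =>
    obtain ⟨i, rfl⟩ := ha
    exact ⟨Pi.single i 1, by simp [hε, Pi.single_apply]⟩
  | algebraMap r => exact ⟨0, by simp⟩
  | add a b _ _ ha hb =>
    obtain ⟨c, hc⟩ := ha
    obtain ⟨d, hd⟩ := hb
    refine ⟨c + d, ?_⟩
    conv_lhs => rw [hc, hd]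
    simp only [map_add, Pi.add_apply, add_mul, Finset.sum_add_distrib]
    abel
  | mul a b _ _ ha hb =>
    obtain ⟨c, hc⟩ := ha
    obtain ⟨d, hd⟩ := hb
    refine ⟨fun i => ε b • c i + a * d i, ?_⟩
    conv_lhs => rw [hd, mul_add, ← Algebra.commutes, ← Algebra.smul_def]
    conv_lhs => lhs; rw [hc]
    have e : algebraMap K A (ε (a * b)) = ε b • algebraMap K A (ε a) := by
      rw [map_mul, mul_comm, map_mul, Algebra.smul_def]
    rw [e]
    simp only [add_mul, Finset.sum_add_distrib, smul_add, Finset.smul_sum, Finset.mul_sum,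
      mul_assoc, smul_mul_assoc, add_assoc]

theorem exists_eq_aug_add_sum_mul' (hx : Algebra.adjoin K (Set.range x) = ⊤)
    (hε : ∀ i, ε (x i) = 0) (a : A) :
    ∃ c : ι → A, a = algebraMap K A (ε a) + ∑ i, x i * c i := by
  classical
  have ha : a ∈ Algebra.adjoin K (Set.range x) := by rw [hx]; trivial
  induction ha using Algebra.adjoin_induction with
  | mem a ha =>
    obtain ⟨i, rfl⟩ := ha
    exact ⟨Pi.single i 1, by simp [hε, Pi.single_apply]⟩
  | algebraMap r => exact ⟨0, by simp⟩
  | add a b _ _ ha hb =>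
    obtain ⟨c, hc⟩ := ha
    obtain ⟨d, hd⟩ := hb
    refine ⟨c + d, ?_⟩
    conv_lhs => rw [hc, hd]
    simp only [map_add, Pi.add_apply, mul_add, Finset.sum_add_distrib]
    abel
  | mul a b _ _ ha hb =>
    obtain ⟨c, hc⟩ := ha
    obtain ⟨d, hd⟩ := hb
    refine ⟨fun i => ε a • d i + c i * b, ?_⟩
    conv_lhs => rw [hc, add_mul, ← Algebra.smul_def]
    conv_lhs => lhs; rw [hd]
    simp only [map_mul, mul_add, Finset.sum_add_distrib, smul_add, Finset.smul_sum, Finset.sum_mul,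
      mul_assoc, mul_smul_comm, Algebra.smul_def (ε a) (algebraMap K A (ε b)), add_assoc]

end TrivialModule

/-! ### Coordinates in the tensor algebra -/

section FreeTensorAlgebra

variable {K : Type u} [Field K] {q : ℕ}

/-- Makes the stripped elements coordinates on E ⊗ S: an element there whose strips all vanish is
zero. -/
theorem sum_ι_mul_stripLeft {S : Submodule K (FreeAlgebra K (Fin q))} {f : FreeAlgebra K (Fin q)}
    (hf : f ∈ genSpace K q * S) : ∑ i, FreeAlgebra.ι K i * stripLeft K q i f = f := by
  let g : FreeAlgebra K (Fin q) →ₗ[K] FreeAlgebra K (Fin q) :=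
    ∑ i, LinearMap.mulLeft K (FreeAlgebra.ι K i) ∘ₗ stripLeft K q i
  have hg : ∀ f, g f = ∑ i, FreeAlgebra.ι K i * stripLeft K q i f := fun f => by simp [g]
  rw [← hg]
  suffices h : genSpace K q * S ≤ LinearMap.eqLocus g LinearMap.id from h hf
  rw [Submodule.mul_le]
  intro m hm s _
  rw [LinearMap.mem_eqLocus, LinearMap.id_apply]
  induction hm using Submodule.span_induction with
  | mem x hx =>
    obtain ⟨j, rfl⟩ := hx
    rw [hg]
    simp [stripLeft_ι_mul]
  | zero => simp
  | add x y _ _ hx hy => rw [add_mul, map_add, hx, hy]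
  | smul c x _ hx => rw [smul_mul_assoc, map_smul, hx]

theorem exists_eq_sum_of_mem_genSpace {f : FreeAlgebra K (Fin q)} (hf : f ∈ genSpace K q) :
    ∃ c : Fin q → K, f = ∑ i, c i • FreeAlgebra.ι K i := by
  obtain ⟨c, hc⟩ := (Submodule.mem_span_range_iff_exists_fun K).1 hf
  exact ⟨c, hc.symm⟩

theorem stripLeft_ι (i j : Fin q) :
    stripLeft K q i (FreeAlgebra.ι K j) = if i = j then 1 else 0 := by
  simpa using stripLeft_ι_mul (K := K) i j 1

theorem exists_eq_sum_of_mem_genSpace_sq {f : FreeAlgebra K (Fin q)} (hf : f ∈ genSpace K q ^ 2) :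
    ∃ c : Matrix (Fin q) (Fin q) K,
      f = ∑ i, ∑ j, c i j • (FreeAlgebra.ι K i * FreeAlgebra.ι K j) := by
  rw [pow_two] at hf
  have h := fun i => exists_eq_sum_of_mem_genSpace (stripLeft_mem_of_mem_genSpace_mul i _ hf)
  choose c hc using h
  refine ⟨c, ?_⟩
  rw [← sum_ι_mul_stripLeft hf]
  simp only [hc, Finset.mul_sum, mul_smul_comm]

end FreeTensorAlgebra

/-! ### The Koszul complex in low degrees -/

namespace QuadraticData

variable {K : Type u} [Field K] {q : ℕ} (P : QuadraticData K q)

theorem proj_ι (i : Fin q) : P.proj (FreeAlgebra.ι K i) = P.gen i := rfl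

theorem proj_eq_zero_of_mem {f : FreeAlgebra K (Fin q)} (hf : f ∈ P.rel) : P.proj f = 0 := by
  rw [← map_zero P.proj]
  exact RingQuot.mkAlgHom_rel K ⟨hf, rfl⟩

theorem adjoin_gen : Algebra.adjoin K (Set.range P.gen) = ⊤ := by
  have h : Set.range P.gen = P.proj '' Set.range (FreeAlgebra.ι K) := by
    rw [← Set.range_comp]
    rfl
  rw [h, ← AlgHom.map_adjoin, FreeAlgebra.adjoin_range_ι, Algebra.map_top, AlgHom.range_eq_top]
  exact RingQuot.mkAlgHom_surjective K _

theorem exists_algHom {C : Type*} [Ring C] [Algebra K C] (y : Fin q → C)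
    (hy : ∀ f ∈ P.rel, FreeAlgebra.lift K y f = 0) : ∃ f : P.Alg →ₐ[K] C, ∀ i, f (P.gen i) = y i :=
  ⟨RingQuot.liftAlgHom K ⟨FreeAlgebra.lift K y, by
    rintro f g ⟨hf, rfl⟩
    rw [hy f hf, map_zero]⟩, fun i => by
      rw [gen, proj, RingQuot.liftAlgHom_mkAlgHom_apply, FreeAlgebra.lift_ι_apply]⟩

@[simp]
theorem augmentation_gen (i : Fin q) : P.augmentation (P.gen i) = 0 := by
  rw [gen, proj, augmentation, RingQuot.liftAlgHom_mkAlgHom_apply, FreeAlgebra.lift_ι_apply]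

/-- The linear part of the elements of a quadratic algebra. -/
theorem exists_linearPart : ∃ δ : P.Alg →ₗ[K] (Fin q → K), (∀ i, δ (P.gen i) = Pi.single i 1) ∧
    ∀ a b, δ (a * b) = P.augmentation a • δ b + P.augmentation b • δ a := by
  -- The generators go to a square-zero ideal, so quadratic elements die and the map descends to the
  -- algebra; its two components are the augmentation and δ.
  let y : Fin q → TrivSqZeroExt K (Fin q → K) := fun i => TrivSqZeroExt.inr (Pi.single i 1)
  have hE : ∀ f ∈ genSpace K q, ∃ v, FreeAlgebra.lift K y f = TrivSqZeroExt.inr v := by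
    intro f hf
    obtain ⟨c, rfl⟩ := exists_eq_sum_of_mem_genSpace hf
    refine ⟨∑ i, c i • Pi.single i 1, ?_⟩
    rw [← TrivSqZeroExt.inrHom_apply K, map_sum, map_sum]
    simp [y]
  obtain ⟨f, hf⟩ := P.exists_algHom y (fun r hr => by
    have h2 : genSpace K q ^ 2 ≤ LinearMap.ker (FreeAlgebra.lift K y).toLinearMap := by
      rw [pow_two, Submodule.mul_le]
      intro m hm n hn
      obtain ⟨v, hv⟩ := hE m hm
      obtain ⟨w, hw⟩ := hE n hn
      simp [hv, hw]
    exact h2 (P.rel_le hr))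
  have hfst : (TrivSqZeroExt.fstHom K K (Fin q → K)).comp f = P.augmentation := by
    refine AlgHom.ext_of_adjoin_eq_top P.adjoin_gen ?_
    rintro _ ⟨i, rfl⟩
    simp [hf, y]
  have hfst' : ∀ a, (f a).fst = P.augmentation a := fun a => AlgHom.congr_fun hfst a
  refine ⟨TrivSqZeroExt.sndHom K (Fin q → K) ∘ₗ f.toLinearMap, fun i => ?_, fun a b => ?_⟩
  · simp [hf, y]
  · simp [hfst']

theorem koszulSpace_zero : P.koszulSpace 0 = 1 := by
  rw [koszulSpace, pow_zero, inf_eq_left]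
  refine le_iInf fun i => le_iInf fun j => le_iInf fun h => ?_
  omega

theorem koszulSpace_one : P.koszulSpace 1 = genSpace K q := by
  rw [koszulSpace, pow_one, inf_eq_left]
  refine le_iInf fun i => le_iInf fun j => le_iInf fun h => ?_
  omega

theorem koszulSpace_two : P.koszulSpace 2 = P.rel := by
  rw [koszulSpace]
  apply le_antisymm
  · refine inf_le_right.trans ((iInf_le _ 0).trans ((iInf_le _ 0).trans ((iInf_le _ rfl).trans ?_)))
    simp
  · refine le_inf P.rel_le (le_iInf fun i => le_iInf fun j => le_iInf fun h => ?_)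
    obtain rfl : i = 0 := by omega
    obtain rfl : j = 0 := by omega
    simp

theorem koszulSpace_le (n : ℕ) : P.koszulSpace n ≤ genSpace K q ^ n := inf_le_left

variable {P} in
theorem eq_zero_of_stripLeft_eq_zero {n : ℕ} {f : FreeAlgebra K (Fin q)}
    (hf : f ∈ P.koszulSpace (n + 1)) (h : ∀ i, stripLeft K q i f = 0) : f = 0 := by
  have := P.koszulSpace_le _ hf
  rw [pow_succ'] at this
  rw [← sum_ι_mul_stripLeft this]
  simp [h]

theorem koszulSpace_succ_eq_bot {n : ℕ} (h : P.koszulSpace n = ⊥) :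
    P.koszulSpace (n + 1) = ⊥ := by
  rw [eq_bot_iff]
  intro f hf
  refine eq_zero_of_stripLeft_eq_zero hf fun i => ?_
  have := P.stripLeft_mem_koszulSpace i n f hf
  rwa [h] at this

/-- The map `W_(n+1) → W_n` which strips off the letter `x^i` on the left. -/
def stripW (i : Fin q) (n : ℕ) : P.koszulSpace (n + 1) →ₗ[K] P.koszulSpace n :=
  (stripLeft K q i).restrict (P.stripLeft_mem_koszulSpace i n)

@[simp]
theorem stripW_coe (i : Fin q) (n : ℕ) (w : P.koszulSpace (n + 1)) :
    (P.stripW i n w : FreeAlgebra K (Fin q)) = stripLeft K q i w := rfl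

theorem koszulD_tmul (n : ℕ) (a : P.Alg) (w : P.koszulSpace (n + 1)) :
    P.koszulD n (a ⊗ₜ w) = ∑ i, (a * P.gen i) ⊗ₜ P.stripW i n w := by
  simp [koszulD, rightMul, stripW]

/-- The multiplication `A ⊗ W_n → A`. -/
def mulW (n : ℕ) : P.Alg ⊗[K] P.koszulSpace n →ₗ[P.Alg] P.Alg :=
  resolutionAug P.Alg ∘ₗ AlgebraTensorModule.map LinearMap.id
    (P.proj.toLinearMap ∘ₗ (P.koszulSpace n).subtype)

@[simp]
theorem mulW_tmul (n : ℕ) (a : P.Alg) (w : P.koszulSpace n) :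
    P.mulW n (a ⊗ₜ w) = a * P.proj w := by
  simp [mulW]

/-- The unit of `W_0 = K`. -/
def oneW : P.koszulSpace 0 := ⟨1, by rw [koszulSpace_zero]; exact Submodule.one_le.1 le_rfl⟩

/-- The generators as elements of `W_1 = E`. -/
def genW (i : Fin q) : P.koszulSpace 1 :=
  ⟨FreeAlgebra.ι K i, by rw [koszulSpace_one]; exact Submodule.subset_span ⟨i, rfl⟩⟩

@[simp] theorem oneW_coe : (P.oneW : FreeAlgebra K (Fin q)) = 1 := rfl

@[simp] theorem genW_coe (i : Fin q) : (P.genW i : FreeAlgebra K (Fin q)) = FreeAlgebra.ι K i := rfl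

theorem exists_eq_smul_oneW (w : P.koszulSpace 0) : ∃ c : K, w = c • P.oneW := by
  obtain ⟨w, hw⟩ := w
  have hw' := hw
  rw [koszulSpace_zero, Submodule.mem_one] at hw'
  obtain ⟨c, rfl⟩ := hw'
  exact ⟨c, Subtype.ext (by simp [Algebra.algebraMap_eq_smul_one])⟩

theorem exists_eq_sum_genW (w : P.koszulSpace 1) : ∃ c : Fin q → K, w = ∑ i, c i • P.genW i := by
  obtain ⟨w, hw⟩ := w
  have hw' := hw
  rw [koszulSpace_one] at hw'
  obtain ⟨c, rfl⟩ := exists_eq_sum_of_mem_genSpace hw'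
  exact ⟨c, Subtype.ext (by simp)⟩

theorem tmul_oneW_mulW (u : P.Alg ⊗[K] P.koszulSpace 0) : P.mulW 0 u ⊗ₜ P.oneW = u := by
  induction u using TensorProduct.induction_on with
  | zero => simp
  | tmul a w =>
    obtain ⟨c, rfl⟩ := P.exists_eq_smul_oneW w
    simp [smul_tmul']
  | add u v hu hv => rw [map_add, add_tmul, hu, hv]

@[simp]
theorem stripW_genW (i j : Fin q) : P.stripW i 0 (P.genW j) = if i = j then P.oneW else 0 := by
  apply Subtype.ext
  rw [stripW_coe, genW_coe, stripLeft_ι]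
  split_ifs <;> rfl

/-- The coefficient of `x^i`, a map `A ⊗ E → A`. -/
def coeffW (i : Fin q) : P.Alg ⊗[K] P.koszulSpace 1 →ₗ[P.Alg] P.Alg :=
  P.mulW 0 ∘ₗ AlgebraTensorModule.map LinearMap.id (P.stripW i 0)

theorem coeffW_tmul (i : Fin q) (a : P.Alg) (w : P.koszulSpace 1) :
    P.coeffW i (a ⊗ₜ w) = a * P.proj (stripLeft K q i w) := by
  simp [coeffW]

@[simp]
theorem coeffW_tmul_genW (i j : Fin q) (a : P.Alg) :
    P.coeffW i (a ⊗ₜ P.genW j) = if i = j then a else 0 := by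
  rw [coeffW_tmul, genW_coe, stripLeft_ι]
  split_ifs <;> simp

theorem sum_coeffW_tmul (u : P.Alg ⊗[K] P.koszulSpace 1) :
    ∑ i, P.coeffW i u ⊗ₜ P.genW i = u := by
  induction u using TensorProduct.induction_on with
  | zero => simp
  | tmul a w =>
    obtain ⟨c, rfl⟩ := P.exists_eq_sum_genW w
    simp only [tmul_sum, map_sum, tmul_smul, LinearMap.map_smul_of_tower, coeffW_tmul_genW]
    refine Finset.sum_congr rfl fun i _ => ?_
    simp [smul_tmul']
  | add u v hu hv =>
    simp only [map_add, add_tmul, Finset.sum_add_distrib]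
    rw [hu, hv]

theorem koszulD_zero_eq (u : P.Alg ⊗[K] P.koszulSpace 1) :
    P.koszulD 0 u = (∑ i, P.coeffW i u * P.gen i) ⊗ₜ P.oneW := by
  conv_lhs => rw [← P.sum_coeffW_tmul u]
  simp only [map_sum, koszulD_tmul, stripW_genW, sum_tmul]
  refine Finset.sum_congr rfl fun i _ => ?_
  rw [Finset.sum_eq_single i]
  · simp
  · intro j _ hj
    simp [hj]
  · simp

/-- The augmentation `A ⊗ W_0 → K` of the Koszul complex. -/
def koszulAug : P.Alg ⊗[K] P.koszulSpace 0 →ₗ[P.Alg] trivialModule P.augmentation :=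
  trivialModuleAug P.augmentation ∘ₗ P.mulW 0

theorem koszulAug_surjective : Function.Surjective P.koszulAug := fun k => by
  obtain ⟨a, rfl⟩ := trivialModuleAug_surjective _ k
  exact ⟨a ⊗ₜ P.oneW, by simp [koszulAug]⟩

theorem koszulAug_exact : Function.Exact (P.koszulD 0) P.koszulAug := by
  intro u
  rw [koszulAug, LinearMap.comp_apply, trivialModuleAug_eq_zero_iff]
  constructor
  · intro h
    obtain ⟨c, hc⟩ := exists_eq_aug_add_sum_mul P.adjoin_gen P.augmentation_gen (P.mulW 0 u)
    rw [h, map_zero, zero_add] at hc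
    refine ⟨∑ i, c i ⊗ₜ P.genW i, ?_⟩
    rw [← P.tmul_oneW_mulW u, hc, koszulD_zero_eq]
    simp
  · rintro ⟨v, rfl⟩
    rw [koszulD_zero_eq]
    simp

end QuadraticData

/-! ### Ext of a module with values in A -/

section LengthTwoResolution

open Abelian

variable {A : Type u} [Ring A] {F₂ F₁ F₀ : Type u} [AddCommGroup F₂] [AddCommGroup F₁]
  [AddCommGroup F₀] [Module A F₂] [Module A F₁] [Module A F₀] {M : ModuleCat.{u} A}
  {d₂ : F₂ →ₗ[A] F₁} {d₁ : F₁ →ₗ[A] F₀} {d₀ : F₀ →ₗ[A] M}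

/-- A resolution of length two computes `Ext²(M, A)`, with its right module structure. -/
theorem exists_toExtTwo [Module.Projective A F₁] [Module.Projective A F₀]
    (h₂ : Function.Injective d₂) (h₁ : Function.Exact d₂ d₁) (h₀ : Function.Exact d₁ d₀)
    (hs : Function.Surjective d₀) :
    ∃ Θ : (F₂ →ₗ[A] A) →+ Ext.{u} M (ModuleCat.of A A) 2, Function.Surjective Θ ∧
      (∀ h, Θ h = 0 ↔ ∃ k : F₁ →ₗ[A] A, k ∘ₗ d₂ = h) ∧
      ∀ h a, (Θ h).comp (Ext.mk₀ (ModuleCat.ofHom (rightMul a))) (add_zero 2) =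
        Θ (rightMul a ∘ₗ h) := by
  have p₁ : Projective (ModuleCat.of A F₁) := (IsProjective.iff_projective F₁).1 inferInstance
  have p₀ : Projective (ModuleCat.of A F₀) := (IsProjective.iff_projective F₀).1 inferInstance
  let Θ := toExtTwo (leftPart_shortExact h₂ h₁) (rightPart_shortExact h₀ hs) (ModuleCat.of A A)
  refine ⟨Θ.comp (ModuleCat.homAddEquiv (M := ModuleCat.of A F₂)
    (N := ModuleCat.of A A)).symm.toAddMonoidHom, ?_, ?_, ?_⟩
  · exact (toExtTwo_surjective _ _ _).comp (AddEquiv.surjective _)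
  · intro h
    refine (toExtTwo_eq_zero_iff _ _ _ _).trans ⟨?_, ?_⟩
    · rintro ⟨k, hk⟩
      exact ⟨k.hom, congrArg ModuleCat.Hom.hom hk⟩
    · rintro ⟨k, rfl⟩
      exact ⟨ModuleCat.ofHom k, rfl⟩
  · intro h a
    exact toExtTwo_comp _ _ _ _

theorem subsingleton_ext_one_of_exact [Module.Projective A F₀] (h₁ : Function.Exact d₂ d₁)
    (h₀ : Function.Exact d₁ d₀) (hs : Function.Surjective d₀)
    (H : ∀ g : F₁ →ₗ[A] A, g ∘ₗ d₂ = 0 → ∃ f : F₀ →ₗ[A] A, f ∘ₗ d₁ = g) :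
    Subsingleton (Ext.{u} M (ModuleCat.of A A) 1) := by
  have p₀ : Projective (ModuleCat.of A F₀) := (IsProjective.iff_projective F₀).1 inferInstance
  have : Epi (leftPart h₁).g :=
    (ModuleCat.epi_iff_surjective _).2 d₁.surjective_rangeRestrict
  refine subsingleton_ext_one (w₁ := (leftPart h₁).zero) (rightPart_shortExact h₀ hs) _
    fun k hk => ?_
  obtain ⟨f, hf⟩ := H k.hom (congrArg ModuleCat.Hom.hom hk)
  exact ⟨ModuleCat.ofHom f, ModuleCat.hom_ext hf⟩

theorem subsingleton_ext_zero {M N : ModuleCat.{u} A} (H : ∀ f : M →ₗ[A] N, f = 0) :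
    Subsingleton (Ext.{u} M N 0) := by
  refine subsingleton_of_forall_eq 0 fun e => ?_
  obtain ⟨f, rfl⟩ := Ext.addEquiv₀.symm.surjective e
  have : f = 0 := ModuleCat.hom_ext (H f.hom)
  rw [this, map_zero]

end LengthTwoResolution

/-! ### Nondegenerate forms give Koszul Gorenstein algebras -/

namespace QuadraticData

variable {K : Type u} [Field K] {q : ℕ}

/-- The quadratic element with the given matrix of coefficients. -/
def quadraticElement (C : Matrix (Fin q) (Fin q) K) : FreeAlgebra K (Fin q) :=
  ∑ i, ∑ j, C i j • (FreeAlgebra.ι K i * FreeAlgebra.ι K j)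

theorem stripLeft_quadraticElement (C : Matrix (Fin q) (Fin q) K) (i : Fin q) :
    stripLeft K q i (quadraticElement C) = ∑ j, C i j • FreeAlgebra.ι K j := by
  simp only [quadraticElement, map_sum, map_smul, stripLeft_ι_mul]
  rw [Finset.sum_eq_single i]
  · simp
  · intro j _ hj
    simp [hj.symm]
  · simp

theorem stripLeft_quadraticElement_mul (C : Matrix (Fin q) (Fin q) K) (i j : Fin q)
    (e : FreeAlgebra K (Fin q)) :
    stripLeft K q j (stripLeft K q i (quadraticElement C * e)) = C i j • e := by
  simp only [quadraticElement, Finset.sum_mul, smul_mul_assoc, mul_assoc, map_sum, map_smul,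
    stripLeft_ι_mul]
  rw [Finset.sum_eq_single i]
  · simp only [if_true, stripLeft_ι_mul]
    simp
  · intro k _ hk
    simp [hk.symm]
  · simp

variable {P : QuadraticData K q} {C : Matrix (Fin q) (Fin q) K}

theorem coeffW_sum_tmul (i : Fin q) (f : Fin q → P.Alg) :
    P.coeffW i (∑ j, f j ⊗ₜ P.genW j) = f i := by
  simp

theorem isOneRelator (hP : P.rel = Submodule.span K {quadraticElement C}) :
    IsOneRelator C P.gen where
  rel := by
    have : P.proj (quadraticElement C) = 0 :=
      P.proj_eq_zero_of_mem (by rw [hP]; exact Submodule.mem_span_singleton_self _)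
    simpa [quadraticElement, proj_ι] using this
  adjoin_eq_top := P.adjoin_gen
  exists_lift D _ _ y hy := P.exists_algHom y (by
    intro f hf
    rw [hP] at hf
    obtain ⟨c, rfl⟩ := Submodule.mem_span_singleton.1 hf
    simp [quadraticElement, hy])

/-- The relation as an element of `W_2 = R`. -/
def relW (hP : P.rel = Submodule.span K {quadraticElement C}) : P.koszulSpace 2 :=
  ⟨quadraticElement C, by
    rw [koszulSpace_two, hP]; exact Submodule.mem_span_singleton_self _⟩

section

variable (hP : P.rel = Submodule.span K {quadraticElement C})

include hP

theorem exists_eq_smul_relW (w : P.koszulSpace 2) : ∃ c : K, w = c • relW hP := by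
  obtain ⟨w, hw⟩ := w
  have hw' := hw
  rw [koszulSpace_two, hP] at hw'
  obtain ⟨c, rfl⟩ := Submodule.mem_span_singleton.1 hw'
  exact ⟨c, rfl⟩

theorem exists_eq_tmul_relW (u : P.Alg ⊗[K] P.koszulSpace 2) : ∃ a : P.Alg, u = a ⊗ₜ relW hP := by
  induction u using TensorProduct.induction_on with
  | zero => exact ⟨0, by simp⟩
  | tmul a w =>
    obtain ⟨c, rfl⟩ := exists_eq_smul_relW hP w
    exact ⟨c • a, by rw [smul_tmul]⟩
  | add u v hu hv =>
    obtain ⟨a, rfl⟩ := hu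
    obtain ⟨b, rfl⟩ := hv
    exact ⟨a + b, by rw [add_tmul]⟩

theorem koszulD_one_relW (a : P.Alg) :
    P.koszulD 1 (a ⊗ₜ relW hP) = ∑ j, (∑ i, C i j • (a * P.gen i)) ⊗ₜ P.genW j := by
  have h : ∀ i, P.stripW i 1 (relW hP) = ∑ j, C i j • P.genW j := fun i => by
    apply Subtype.ext
    rw [stripW_coe, relW, stripLeft_quadraticElement]
    simp
  simp only [koszulD_tmul, h, tmul_sum, sum_tmul]
  rw [Finset.sum_comm]
  simp only [tmul_smul, smul_tmul']

theorem koszul_exact_zero : Function.Exact (P.koszulD 1) (P.koszulD 0) := by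
  intro u
  constructor
  · intro hu
    rw [koszulD_zero_eq] at hu
    have h0 : ∑ i, P.coeffW i u * P.gen i = 0 := by
      have := congrArg (P.mulW 0) hu
      simpa using this
    obtain ⟨g, hg⟩ := (isOneRelator hP).exists_of_sum_eq_zero h0
    refine ⟨g ⊗ₜ relW hP, ?_⟩
    rw [koszulD_one_relW]
    simp only [← hg]
    exact P.sum_coeffW_tmul u
  · rintro ⟨v, rfl⟩
    obtain ⟨a, rfl⟩ := exists_eq_tmul_relW hP v
    rw [koszulD_one_relW, koszulD_zero_eq]
    have h0 : ∑ i, ∑ j, C i j • (a * P.gen i * P.gen j) = 0 := by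
      simpa [Finset.mul_sum, mul_assoc] using congrArg (a * ·) (isOneRelator hP).rel
    rw [Finset.sum_comm] at h0
    simp [Finset.sum_mul, h0]

/-- Each coordinate of the image of a ⊗ r is `a` times the linear form given by a column of C, which
is nonzero and hence right regular. -/
theorem koszulD_one_injective (hq : 2 ≤ q) (hC : IsUnit C.det) :
    Function.Injective (P.koszulD 1) := by
  rw [injective_iff_map_eq_zero]
  intro u hu
  obtain ⟨a, rfl⟩ := exists_eq_tmul_relW hP u
  rw [koszulD_one_relW] at hu
  let j : Fin q := ⟨0, by omega⟩
  have h := congrArg (P.coeffW j) hu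
  simp only [map_sum, coeffW_tmul_genW, map_zero] at h
  have hcol : (fun i => C i j) ≠ 0 := by
    intro h0
    exact hC.ne_zero (Matrix.det_eq_zero_of_column_eq_zero j (congrFun h0))
  have ha : a = 0 := (isOneRelator hP).eq_zero_of_mul_eq_zero hq hC hcol (by simpa using h)
  rw [ha, zero_tmul]

/-- An element of E⊗R ∩ R⊗E has the form v⊗r = r⊗w. Contracting the last factor gives, in A, the
product of v with a column form of C as a multiple of the relation, so v = 0 by regularity. -/
theorem koszulSpace_three_eq_bot (hq : 2 ≤ q) (hC : IsUnit C.det) : P.koszulSpace 3 = ⊥ := by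
  rw [eq_bot_iff]
  intro f hf
  have h2 : ∀ i, ∃ v : K, stripLeft K q i f = v • quadraticElement C := fun i => by
    have := P.stripLeft_mem_koszulSpace i 2 f hf
    rw [koszulSpace_two, hP] at this
    obtain ⟨v, hv⟩ := Submodule.mem_span_singleton.1 this
    exact ⟨v, hv.symm⟩
  choose v hv using h2
  have h1 : f ∈ P.rel * genSpace K q := by
    have h := (Submodule.mem_inf.1 hf).2
    simp only [Submodule.mem_iInf] at h
    simpa using h 0 1 rfl
  rw [hP, Submodule.mem_span_singleton_mul] at h1
  obtain ⟨e, he, rfl⟩ := h1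
  obtain ⟨w, rfl⟩ := exists_eq_sum_of_mem_genSpace he
  -- The two expressions for the coefficient of x^i x^j x^k.
  have hvw : ∀ i j k, v i * C j k = C i j * w k := fun i j k => by
    have h := congrArg (fun g => FreeAlgebra.algebraMapInv (stripLeft K q k (stripLeft K q j g)))
      (hv i)
    simp only [stripLeft_quadraticElement_mul, map_smul, stripLeft_quadraticElement, map_sum,
      stripLeft_ι] at h
    simpa using h.symm
  have hrel := (isOneRelator hP).rel
  let k : Fin q := ⟨0, by omega⟩
  have hcol : (fun i => C i k) ≠ 0 := by
    intro h0
    exact hC.ne_zero (Matrix.det_eq_zero_of_column_eq_zero k (congrFun h0))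
  have ha : ∑ i, v i • P.gen i = 0 := by
    refine (isOneRelator hP).eq_zero_of_mul_eq_zero hq hC hcol ?_
    calc ∑ j, C j k • ((∑ i, v i • P.gen i) * P.gen j)
        = w k • ∑ i, ∑ j, C i j • (P.gen i * P.gen j) := by
          simp only [Finset.sum_mul, Finset.smul_sum, smul_mul_assoc, smul_smul]
          rw [Finset.sum_comm]
          refine Finset.sum_congr rfl fun i _ => Finset.sum_congr rfl fun j _ => ?_
          rw [mul_comm, hvw, mul_comm]
      _ = 0 := by rw [hrel, smul_zero]
  obtain ⟨δ, hδ, -⟩ := P.exists_linearPart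
  have hv0 : ∀ i, v i = 0 := fun i => by
    have := congrFun (congrArg δ ha) i
    simpa [hδ, Pi.single_apply] using this
  exact eq_zero_of_stripLeft_eq_zero hf fun i => by rw [hv, hv0, zero_smul]

end

theorem subsingleton_tensor_of_eq_bot {n : ℕ} (h : P.koszulSpace n = ⊥) :
    Subsingleton (P.Alg ⊗[K] P.koszulSpace n) := by
  refine subsingleton_of_forall_eq 0 fun u => ?_
  induction u using TensorProduct.induction_on with
  | zero => rfl
  | tmul a w =>
    have : w = 0 := Subtype.ext ((Submodule.eq_bot_iff _).1 h w w.2)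
    rw [this, tmul_zero]
  | add u v hu hv => rw [hu, hv, add_zero]

theorem isKoszul (hP : P.rel = Submodule.span K {quadraticElement C}) (hq : 2 ≤ q)
    (hC : IsUnit C.det) : P.IsKoszul := by
  have hW : ∀ n, P.koszulSpace (n + 3) = ⊥ := fun n => by
    induction n with
    | zero => exact koszulSpace_three_eq_bot hP hq hC
    | succ n ih => exact P.koszulSpace_succ_eq_bot ih
  have hsub : ∀ n, Subsingleton (P.Alg ⊗[K] P.koszulSpace (n + 3)) := fun n =>
    subsingleton_tensor_of_eq_bot (hW n)
  rintro (_ | _ | n)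
  · exact koszul_exact_zero hP
  · intro u
    constructor
    · intro hu
      refine ⟨0, ?_⟩
      rw [map_zero]
      exact (koszulD_one_injective hP hq hC (by rw [hu, map_zero])).symm
    · rintro ⟨v, rfl⟩
      have := hsub 0
      rw [Subsingleton.elim v 0, map_zero, map_zero]
  · intro u
    have := hsub n
    have := hsub (n + 1)
    refine ⟨fun _ => ⟨0, Subsingleton.elim _ _⟩, ?_⟩
    rintro ⟨v, rfl⟩
    rw [Subsingleton.elim v 0, map_zero, map_zero]

theorem exists_toExtTwo_koszul (P : QuadraticData K q) (h₂ : Function.Injective (P.koszulD 1))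
    (h₁ : Function.Exact (P.koszulD 1) (P.koszulD 0)) :
    ∃ Θ : (P.Alg ⊗[K] P.koszulSpace 2 →ₗ[P.Alg] P.Alg) →+
        Abelian.Ext.{u} (trivialModule P.augmentation) (ModuleCat.of P.Alg P.Alg) 2,
      Function.Surjective Θ ∧
      (∀ h, Θ h = 0 ↔ ∃ k : P.Alg ⊗[K] P.koszulSpace 1 →ₗ[P.Alg] P.Alg, k ∘ₗ P.koszulD 1 = h) ∧
      ∀ h a, (Θ h).comp (Abelian.Ext.mk₀ (ModuleCat.ofHom (rightMul a))) (add_zero 2) =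
        Θ (rightMul a ∘ₗ h) :=
  exists_toExtTwo (F₂ := P.Alg ⊗[K] P.koszulSpace 2) (F₁ := P.Alg ⊗[K] P.koszulSpace 1)
    (F₀ := P.Alg ⊗[K] P.koszulSpace 0) (M := trivialModule P.augmentation) (d₂ := P.koszulD 1)
    (d₁ := P.koszulD 0) (d₀ := P.koszulAug) h₂ h₁ P.koszulAug_exact P.koszulAug_surjective

/-- The homomorphism of left modules `A ⊗ W_n → A` induced by a linear form on `W_n`. -/
def dualW (P : QuadraticData K q) {n : ℕ} (ω : Module.Dual K (P.koszulSpace n)) :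
    P.Alg ⊗[K] P.koszulSpace n →ₗ[P.Alg] P.Alg :=
  (AlgebraTensorModule.rid K P.Alg P.Alg).toLinearMap ∘ₗ
    AlgebraTensorModule.map LinearMap.id ω

@[simp]
theorem dualW_tmul {n : ℕ} (ω : Module.Dual K (P.koszulSpace n)) (a : P.Alg)
    (w : P.koszulSpace n) : P.dualW ω (a ⊗ₜ w) = ω w • a := by
  simp [dualW]

theorem exists_dual_eq_one {V : Type*} [AddCommGroup V] [Module K V] {v : V} (hv : v ≠ 0) :
    ∃ ω : Module.Dual K V, ω v = 1 := by
  obtain ⟨ω, hω⟩ := not_forall.1 ((Module.forall_dual_apply_eq_zero_iff K v).not.2 hv)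
  exact ⟨(ω v)⁻¹ • ω, by simp [hω]⟩

theorem relW_ne_zero (hP : P.rel = Submodule.span K {quadraticElement C}) (hq : 2 ≤ q)
    (hC : IsUnit C.det) : relW hP ≠ 0 := by
  intro h
  have hC0 : C = 0 := by
    ext i j
    have := congrArg (fun g => FreeAlgebra.algebraMapInv (stripLeft K q j (stripLeft K q i g)))
      (congrArg Subtype.val h)
    simp only [relW] at this
    rw [← mul_one (quadraticElement C), stripLeft_quadraticElement_mul] at this
    simpa using this
  have : Nonempty (Fin q) := ⟨⟨0, by omega⟩⟩
  rw [hC0, Matrix.det_zero] at hC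
  exact not_isUnit_zero hC

theorem isGorenstein (hP : P.rel = Submodule.span K {quadraticElement C}) (hq : 2 ≤ q)
    (hC : IsUnit C.det) : P.IsGorenstein 2 := by
  have h₂ := koszulD_one_injective hP hq hC
  have h₁ := koszul_exact_zero hP
  have hA := isOneRelator hP
  have hpd := hA.hasProjectiveDimensionLT_three hq hC (trivialModule P.augmentation)
  constructor
  · intro n hn
    obtain rfl | rfl | hn : n = 0 ∨ n = 1 ∨ 3 ≤ n := by omega
    -- The image of K in A is annihilated on the left by the generators, which are left regular.
    · refine subsingleton_ext_zero fun f => LinearMap.ext fun k => ?_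
      refine hA.eq_zero_of_gen_mul_eq_zero hq hC ⟨0, by omega⟩ ?_
      rw [← smul_eq_mul, ← map_smul, trivialModule_smul, augmentation_gen, zero_mul]
      exact map_zero f
    · refine subsingleton_ext_one_of_exact (F₂ := P.Alg ⊗[K] P.koszulSpace 2)
        (F₁ := P.Alg ⊗[K] P.koszulSpace 1) (F₀ := P.Alg ⊗[K] P.koszulSpace 0)
        (M := trivialModule P.augmentation) (d₂ := P.koszulD 1) (d₁ := P.koszulD 0)
        (d₀ := P.koszulAug) h₁ P.koszulAug_exact P.koszulAug_surjective
        fun g hg => ?_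
      -- A cocycle is a family c_j = g(1 ⊗ x^j) with ∑ C_ij x^i c_j = 0. Exactness of the dual
      -- complex gives c_j = x^j c, the coboundary of right multiplication by c.
      have h0 : ∑ i, ∑ j, C i j • (P.gen i * g (1 ⊗ₜ P.genW j)) = 0 := by
        have := LinearMap.congr_fun hg (1 ⊗ₜ relW hP)
        rw [LinearMap.comp_apply, koszulD_one_relW, map_sum] at this
        rw [Finset.sum_comm]
        refine Eq.trans (Finset.sum_congr rfl fun j _ => ?_) this
        have e : (∑ i, C i j • (1 * P.gen i)) ⊗ₜ[K] P.genW j =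
            (∑ i, C i j • P.gen i) • ((1 : P.Alg) ⊗ₜ[K] P.genW j) := by
          simp [smul_tmul']
        rw [e, map_smul, smul_eq_mul, Finset.sum_mul]
        simp
      obtain ⟨c, hc⟩ := hA.exists_of_sum_smul_eq_zero hC h0
      refine ⟨rightMul c ∘ₗ P.mulW 0, LinearMap.ext fun u => ?_⟩
      conv_rhs => rw [← P.sum_coeffW_tmul u]
      have e : ∀ i, P.coeffW i u ⊗ₜ[K] P.genW i = P.coeffW i u • ((1 : P.Alg) ⊗ₜ[K] P.genW i) :=
        fun i => by simp [smul_tmul']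
      simp only [e, map_sum, map_smul, hc]
      simp [koszulD_zero_eq, rightMul, mul_assoc]
    · exact HasProjectiveDimensionLT.subsingleton _ 3 n hn _
  · obtain ⟨Θ, hΘs, hΘ0, hΘr⟩ := P.exists_toExtTwo_koszul h₂ h₁
    -- The form ω identifies W_2 with K, hence Hom(A ⊗ W_2, A) with A acting by right
    -- multiplications.
    obtain ⟨ω, hω⟩ := exists_dual_eq_one (K := K) (relW_ne_zero hP hq hC)
    have hh : ∀ h : P.Alg ⊗[K] P.koszulSpace 2 →ₗ[P.Alg] P.Alg,
        h = rightMul (h (1 ⊗ₜ relW hP)) ∘ₗ P.dualW ω := fun h => by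
      refine LinearMap.ext fun u => ?_
      obtain ⟨a, rfl⟩ := exists_eq_tmul_relW hP u
      have e : a ⊗ₜ[K] relW hP = a • ((1 : P.Alg) ⊗ₜ[K] relW hP) := by simp [smul_tmul']
      rw [e, map_smul, map_smul]
      simp [rightMul, hω]
    let ψ : P.Alg →+ Abelian.Ext.{u} (trivialModule P.augmentation) (ModuleCat.of P.Alg P.Alg) 2 :=
      { toFun := fun a => Θ (rightMul a ∘ₗ P.dualW ω)
        map_zero' := by
          rw [← map_zero Θ]
          congr 1
          ext
          simp [rightMul]
        map_add' := fun a b => by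
          rw [← map_add Θ]
          congr 1
          refine LinearMap.ext fun u => ?_
          simp [rightMul, mul_add] }
    have hψ : ∀ a, ψ a = Θ (rightMul a ∘ₗ P.dualW ω) := fun a => rfl
    have hψs : Function.Surjective ψ := fun e => by
      obtain ⟨h, rfl⟩ := hΘs e
      exact ⟨h (1 ⊗ₜ relW hP), by rw [hψ, ← hh h]⟩
    have hψr : ∀ a c, (ψ a).comp (Abelian.Ext.mk₀ (ModuleCat.ofHom (rightMul c))) (add_zero 2) =
        ψ (a * c) := fun a c => by
      rw [hψ, hΘr, hψ]
      congr 1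
      refine LinearMap.ext fun u => ?_
      simp [rightMul, mul_assoc]
    -- The coboundaries form the right ideal generated by the ∑_i C_ij x^i, which for invertible C
    -- is the augmentation ideal.
    have hψ0 : ∀ a, ψ a = 0 ↔ P.augmentation a = 0 := fun a => by
      rw [hψ, hΘ0]
      constructor
      · rintro ⟨k, hk⟩
        have := LinearMap.congr_fun hk (1 ⊗ₜ relW hP)
        rw [LinearMap.comp_apply, koszulD_one_relW, map_sum] at this
        simp only [LinearMap.comp_apply, dualW_tmul, hω, one_smul] at this
        have e : ∀ j, (∑ i, C i j • (1 * P.gen i)) ⊗ₜ[K] P.genW j =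
            (∑ i, C i j • P.gen i) • ((1 : P.Alg) ⊗ₜ[K] P.genW j) := fun j => by
          simp [smul_tmul']
        simp only [e, map_smul, smul_eq_mul] at this
        have h3 := congrArg P.augmentation this
        simp [rightMul] at h3
        exact h3.symm
      · intro ha
        obtain ⟨c, hc⟩ := exists_eq_aug_add_sum_mul' P.adjoin_gen P.augmentation_gen a
        rw [ha, map_zero, zero_add] at hc
        -- Chosen so that ∑_j (∑_i C_ij x^i) d_j = ∑_i x^i c_i.
        let d : Fin q → P.Alg := fun j => ∑ i, C⁻¹ j i • c i
        refine ⟨∑ j, rightMul (d j) ∘ₗ P.coeffW j, LinearMap.ext fun u => ?_⟩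
        obtain ⟨b, rfl⟩ := exists_eq_tmul_relW hP u
        rw [LinearMap.comp_apply, koszulD_one_relW]
        simp only [LinearMap.sum_apply, LinearMap.comp_apply, coeffW_sum_tmul, dualW_tmul, hω,
          one_smul]
        simp only [rightMul, LinearMap.toSpanSingleton_apply, smul_eq_mul]
        rw [hc, Finset.mul_sum]
        simp only [d, Finset.sum_mul, Finset.mul_sum, smul_mul_assoc, mul_smul_comm]
        rw [Finset.sum_comm]
        refine Finset.sum_congr rfl fun i _ => ?_
        simp only [Finset.smul_sum, smul_smul]
        rw [Finset.sum_comm]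
        simp only [mul_comm (C⁻¹ _ _), ← Finset.sum_smul, ← Matrix.mul_apply, Matrix.mul_nonsing_inv C hC,
          Matrix.one_apply, ite_smul, one_smul, zero_smul]
        simp [mul_assoc]
    let χ := ψ.comp (algebraMap K P.Alg).toAddMonoidHom
    have hχ : ∀ k, χ k = ψ (algebraMap K P.Alg k) := fun k => rfl
    have hψχ : ∀ a, ψ a = χ (P.augmentation a) := fun a => by
      rw [← sub_eq_zero, hχ, ← map_sub, hψ0]
      simp
    have hχb : Function.Bijective χ := by
      refine ⟨(injective_iff_map_eq_zero _).2 fun k hk => ?_, fun e => ?_⟩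
      · rw [hχ, hψ0] at hk
        simpa using hk
      · obtain ⟨a, rfl⟩ := hψs e
        exact ⟨_, (hψχ a).symm⟩
    let φ := AddEquiv.ofBijective χ hχb
    have hφ : ∀ k, φ k = χ k := fun k => rfl
    refine ⟨φ.symm, fun e a => ?_⟩
    obtain ⟨k, rfl⟩ := φ.surjective e
    rw [AddEquiv.symm_apply_apply, AddEquiv.symm_apply_eq, hφ, hφ, hχ, hψr, hψχ]
    simp

/-- The lower bound holds because Ext²(K, A) ≅ K is nonzero. -/
theorem leftGlobalDimension_eq_two (hP : P.rel = Submodule.span K {quadraticElement C})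
    (hq : 2 ≤ q) (hC : IsUnit C.det) : leftGlobalDimension P.Alg = 2 := by
  apply le_antisymm
  · refine iSup_le fun M => ?_
    exact (projectiveDimension_le_iff M 2).2
      ((isOneRelator hP).hasProjectiveDimensionLT_three hq hC M)
  · refine le_trans ?_ (le_iSup _ (trivialModule P.augmentation))
    refine (projectiveDimension_ge_iff _ 2).2 fun h => ?_
    obtain ⟨φ, -⟩ := (isGorenstein hP hq hC).2
    have := HasProjectiveDimensionLT.subsingleton.{u} (trivialModule P.augmentation) 2 2 le_rfl
      (ModuleCat.of P.Alg P.Alg)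
    exact one_ne_zero (φ.symm.injective (Subsingleton.elim (φ.symm 1) (φ.symm 0)))

end QuadraticData

/-! ### The converse: recovering the form -/

namespace QuadraticData

variable {K : Type u} [Field K] {q : ℕ} (P : QuadraticData K q)

/-- The map `A ⊗ W_n → W_n` induced by the augmentation of `A`. -/
def augW (n : ℕ) : P.Alg ⊗[K] P.koszulSpace n →ₗ[K] P.koszulSpace n :=
  (TensorProduct.lid K (P.koszulSpace n)).toLinearMap ∘ₗ
    P.augmentation.toLinearMap.rTensor (P.koszulSpace n)

@[simp]
theorem augW_tmul (n : ℕ) (a : P.Alg) (w : P.koszulSpace n) :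
    P.augW n (a ⊗ₜ w) = P.augmentation a • w := by
  simp [augW]

theorem augW_smul (n : ℕ) (a : P.Alg) (u : P.Alg ⊗[K] P.koszulSpace n) :
    P.augW n (a • u) = P.augmentation a • P.augW n u := by
  induction u using TensorProduct.induction_on with
  | zero => simp
  | tmul b w => simp [smul_tmul', mul_smul]
  | add u v hu hv => rw [smul_add, map_add, map_add, hu, hv, smul_add]

/-- The Koszul complex is minimal. -/
theorem augW_koszulD (n : ℕ) (u : P.Alg ⊗[K] P.koszulSpace (n + 1)) :
    P.augW n (P.koszulD n u) = 0 := by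
  induction u using TensorProduct.induction_on with
  | zero => simp
  | tmul a w => simp [koszulD_tmul]
  | add u v hu hv => rw [map_add, map_add, hu, hv, add_zero]

variable {P}

/-- A minimal resolution has no superfluous terms: the projection p onto the cycles in A ⊗ W_2 would
otherwise express a boundary d(1 ⊗ w) through elements of the augmentation ideal. -/
theorem koszulSpace_three_eq_bot_of_hasProjectiveDimensionLT (hP : P.IsKoszul)
    (hpd : HasProjectiveDimensionLT (trivialModule P.augmentation) 3) : P.koszulSpace 3 = ⊥ := by
  obtain ⟨p, hp0, hp⟩ := exists_projection_ker (F₂ := P.Alg ⊗[K] P.koszulSpace 2)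
    (F₁ := P.Alg ⊗[K] P.koszulSpace 1) (F₀ := P.Alg ⊗[K] P.koszulSpace 0)
    (M := trivialModule P.augmentation) (d₂ := P.koszulD 1) (d₁ := P.koszulD 0)
    (d₀ := P.koszulAug) (hP 0) P.koszulAug_exact P.koszulAug_surjective
  rw [Submodule.eq_bot_iff]
  intro f hf
  let w : P.koszulSpace 3 := ⟨f, hf⟩
  have hz : ∀ i, ∃ z, P.koszulD 2 z = p (1 ⊗ₜ P.stripW i 2 w) := fun i => (hP 1 _).1 (hp0 _)
  choose z hz using hz
  have hd : P.koszulD 2 (1 ⊗ₜ w) = ∑ i, P.gen i • ((1 : P.Alg) ⊗ₜ[K] P.stripW i 2 w) := by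
    rw [koszulD_tmul]
    simp [smul_tmul']
  -- Since p fixes d(1 ⊗ w) = ∑ x^i (1 ⊗ w_i), it equals ∑ x^i d(z_i). The difference 1 ⊗ w − ∑ x^i
  -- z_i is then a boundary, and augmenting it gives w = 0 by minimality.
  have hd' : P.koszulD 2 (1 ⊗ₜ w - ∑ i, P.gen i • z i) = 0 := by
    rw [map_sub, ← hp (P.koszulD 2 (1 ⊗ₜ w)) ((hP 1).apply_apply_eq_zero _), hd]
    simp [hz]
  obtain ⟨t, ht⟩ := (hP 2 _).1 hd'
  have h := P.augW_koszulD 3 t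
  rw [ht] at h
  simp only [map_sub, map_sum, augW_smul, augW_tmul, map_one, one_smul, augmentation_gen,
    zero_smul, Finset.sum_const_zero, sub_zero] at h
  exact congrArg Subtype.val h

theorem exists_matrix_of_isGorenstein (hP : P.IsKoszul) (hgl : leftGlobalDimension P.Alg = 2)
    (hG : P.IsGorenstein 2) : ∃ C : Matrix (Fin q) (Fin q) K,
      IsUnit C.det ∧ P.rel = Submodule.span K {quadraticElement C} := by
  have hpd : HasProjectiveDimensionLT (trivialModule P.augmentation) 3 :=
    (projectiveDimension_le_iff _ 2).1 ((le_iSup _ _).trans hgl.le)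
  have hsub := subsingleton_tensor_of_eq_bot
    (koszulSpace_three_eq_bot_of_hasProjectiveDimensionLT hP hpd)
  have h₂ : Function.Injective (P.koszulD 1) := by
    rw [injective_iff_map_eq_zero]
    intro u hu
    obtain ⟨v, rfl⟩ := (hP 1 u).1 hu
    rw [Subsingleton.elim v 0, map_zero]
  obtain ⟨Θ, hΘs, hΘ0, hΘr⟩ := P.exists_toExtTwo_koszul h₂ (hP 0)
  obtain ⟨φ, hφ⟩ := hG.2
  have hφr : ∀ h a, φ (Θ (rightMul a ∘ₗ h)) = φ (Θ h) * P.augmentation a := fun h a => by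
    rw [← hΘr, hφ]
  have hker : ∀ h, φ (Θ h) = 0 → ∃ k : P.Alg ⊗[K] P.koszulSpace 1 →ₗ[P.Alg] P.Alg,
      k ∘ₗ P.koszulD 1 = h := fun h hh => (hΘ0 h).1 (by simpa using hh)
  let ψ : Module.Dual K (P.koszulSpace 2) →ₗ[K] K :=
    { toFun := fun ω => φ (Θ (P.dualW ω))
      map_add' := fun ω η => by
        rw [← map_add, ← map_add]
        congr 2
        ext
        simp [add_smul]
      map_smul' := fun c ω => by
        have e : P.dualW (c • ω) = rightMul (algebraMap K P.Alg c) ∘ₗ P.dualW ω := by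
          refine LinearMap.ext fun u => ?_
          induction u using TensorProduct.induction_on with
          | zero => rw [map_zero, map_zero]
          | tmul a w =>
            rw [LinearMap.comp_apply, dualW_tmul, dualW_tmul, rightMul,
              LinearMap.toSpanSingleton_apply, smul_eq_mul, ← Algebra.commutes,
              ← Algebra.smul_def, smul_smul]
            rfl
          | add u v hu hv => rw [map_add, map_add, hu, hv]
        rw [e, hφr]
        simp [mul_comm] }
  -- If the cochain of ω is a coboundary, its value at 1 ⊗ w lies in the augmentation ideal, yet
  -- this value is the scalar ω(w).
  have hψ : Function.Injective ψ := by
    rw [injective_iff_map_eq_zero]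
    intro ω hω
    obtain ⟨k, hk⟩ := hker _ hω
    ext w
    have h := LinearMap.congr_fun hk (1 ⊗ₜ w)
    have h1 : P.koszulD 1 (1 ⊗ₜ w) = ∑ i, P.gen i • ((1 : P.Alg) ⊗ₜ[K] P.stripW i 1 w) := by
      rw [koszulD_tmul]
      simp [smul_tmul']
    rw [LinearMap.comp_apply, h1, dualW_tmul] at h
    have h3 := congrArg P.augmentation h
    simpa using h3.symm
  have : Module.Finite K (Module.Dual K (P.koszulSpace 2)) := Module.Finite.of_injective ψ hψ
  have : Module.Finite K (P.koszulSpace 2) := (Module.finite_dual_iff K).1 this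
  have hrank : Module.finrank K (P.koszulSpace 2) ≤ 1 := by
    rw [← Subspace.dual_finrank_eq]
    simpa using LinearMap.finrank_le_finrank_of_injective hψ
  obtain ⟨⟨b, hb⟩, hb1⟩ := finrank_le_one_iff.1 hrank
  obtain ⟨C, hC⟩ := exists_eq_sum_of_mem_genSpace_sq (P.koszulSpace_le 2 hb)
  change b = quadraticElement C at hC
  subst hC
  have hrel : P.rel = Submodule.span K {quadraticElement C} := by
    rw [← koszulSpace_two]
    apply le_antisymm
    · intro f hf
      obtain ⟨c, hc⟩ := hb1 ⟨f, hf⟩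
      exact Submodule.mem_span_singleton.2 ⟨c, congrArg Subtype.val hc⟩
    · rwa [Submodule.span_singleton_le_iff_mem]
  refine ⟨C, ?_, hrel⟩
  -- So far R could be zero; then Hom(A ⊗ W_2, A), and with it Ext² ≅ K, would vanish.
  have hne : relW hrel ≠ 0 := by
    intro h0
    obtain ⟨h, hh⟩ := hΘs (φ.symm 1)
    have : h = 0 := by
      refine LinearMap.ext fun u => ?_
      obtain ⟨a, rfl⟩ := exists_eq_tmul_relW hrel u
      rw [h0, tmul_zero, map_zero, map_zero]
    rw [this, map_zero] at hh
    exact one_ne_zero (φ.symm.injective (hh.symm.trans φ.symm.map_zero.symm))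
  obtain ⟨ω, hω⟩ := exists_dual_eq_one (K := K) hne
  obtain ⟨δ, hδ, hδm⟩ := P.exists_linearPart
  -- The generator x^i kills Ext², so x^i = ∑_j (∑_l C_lj x^l) k_j for some k_j in A. The linear
  -- part of this identity says that C sends the vector of augmentations of the k_j to e_i.
  have hX : ∀ i, ∃ c : Fin q → K, C.mulVec c = Pi.single i 1 := fun i => by
    obtain ⟨k, hk⟩ := hker (rightMul (P.gen i) ∘ₗ P.dualW ω) (by simp [hφr])
    have h := LinearMap.congr_fun hk (1 ⊗ₜ relW hrel)
    have e : ∀ j, (∑ i, C i j • (1 * P.gen i)) ⊗ₜ[K] P.genW j =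
        (∑ i, C i j • P.gen i) • ((1 : P.Alg) ⊗ₜ[K] P.genW j) := fun j => by
      simp [smul_tmul']
    rw [LinearMap.comp_apply, koszulD_one_relW, map_sum] at h
    simp only [e, map_smul, smul_eq_mul, LinearMap.comp_apply, dualW_tmul, hω, one_smul] at h
    have hδ' := congrArg δ h
    simp only [rightMul, LinearMap.toSpanSingleton_apply, one_smul, hδ, map_sum, hδm, map_smul,
      augmentation_gen, smul_zero, Finset.sum_const_zero, zero_smul, zero_add] at hδ'
    refine ⟨fun j => P.augmentation (k (1 ⊗ₜ P.genW j)), ?_⟩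
    rw [← hδ']
    ext l
    simp [Matrix.mulVec, dotProduct, Pi.single_apply, mul_comm]
  choose X hX using hX
  refine Matrix.isUnit_det_of_right_inverse (B := Matrix.of fun j i => X i j) ?_
  ext l i
  have := congrFun (hX i) l
  rw [Matrix.mul_apply, Matrix.one_apply]
  simpa [Matrix.mulVec, dotProduct, Pi.single_apply] using this

/-! ### Components of a form, and congruent forms -/

/-- The matrix of the components of a bilinear form in the canonical basis. -/
def componentMatrix (B : LinearMap.BilinForm K (Fin q → K)) : Matrix (Fin q) (Fin q) K :=
  Matrix.of fun i j => B (Pi.single i 1) (Pi.single j 1)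

theorem ofBilin_rel (B : LinearMap.BilinForm K (Fin q → K)) :
    (ofBilin B).rel = Submodule.span K {quadraticElement (componentMatrix B)} :=
  rfl

theorem isUnit_det_componentMatrix_iff (B : LinearMap.BilinForm K (Fin q → K)) :
    IsUnit (componentMatrix B).det ↔ B.Nondegenerate := by
  have h : componentMatrix B = LinearMap.BilinForm.toMatrix' B := by
    ext i j
    simp [componentMatrix]
  rw [h, isUnit_iff_ne_zero, ← Matrix.nondegenerate_iff_det_ne_zero,
    LinearMap.BilinForm.nondegenerate_toMatrix'_iff]

theorem componentMatrix_toBilin' (C : Matrix (Fin q) (Fin q) K) :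
    componentMatrix (Matrix.toBilin' C) = C := by
  ext i j
  simp [componentMatrix]

/-- The generators transform like coordinate functions, that is, by pullback along L⁻¹; this turns
the relation of B into that of B'. -/
theorem exists_algHom_of_congr (B B' : LinearMap.BilinForm K (Fin q → K))
    (L : (Fin q → K) ≃ₗ[K] (Fin q → K)) (h : LinearMap.BilinForm.congr L B = B') :
    ∃ f : (ofBilin B).Alg →ₐ[K] (ofBilin B').Alg,
      ∀ i, f ((ofBilin B).gen i) = ∑ k, L.symm (Pi.single k 1) i • (ofBilin B').gen k := by
  refine (isOneRelator (ofBilin_rel B)).exists_lift _ _ ?_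
  have hB' : ∀ k l, componentMatrix B' k l = ∑ i, ∑ j,
      componentMatrix B i j * (L.symm (Pi.single k 1) i * L.symm (Pi.single l 1) j) := by
    intro k l
    have e : ∀ v : Fin q → K, v = ∑ i, v i • Pi.single i (1 : K) := fun v => by
      ext j
      simp [Pi.single_apply]
    simp only [componentMatrix, Matrix.of_apply, ← h, LinearMap.BilinForm.congr_apply]
    conv_lhs => rw [e (L.symm (Pi.single k 1)), e (L.symm (Pi.single l 1))]
    simp only [map_sum, LinearMap.sum_apply, map_smul, LinearMap.smul_apply, smul_eq_mul,
      Finset.mul_sum]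
    rw [Finset.sum_comm]
    refine Finset.sum_congr rfl fun i _ => Finset.sum_congr rfl fun j _ => ?_
    ring
  have hrel := (isOneRelator (ofBilin_rel B')).rel
  simp only [hB', Finset.sum_smul] at hrel
  rw [← hrel]
  simp only [Finset.sum_mul, Finset.mul_sum, smul_mul_smul_comm, Finset.smul_sum, smul_smul]
  refine (Finset.sum_congr rfl fun i _ =>
    (Finset.sum_congr rfl fun j _ => Finset.sum_comm).trans Finset.sum_comm).trans ?_
  rw [Finset.sum_comm]
  refine Finset.sum_congr rfl fun k _ => ?_
  exact (Finset.sum_congr rfl fun i _ => Finset.sum_comm).trans Finset.sum_comm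

/-- The substitutions attached to L and to L⁻¹ are mutually inverse on generators, and each sends
generators to linear combinations of generators. -/
theorem exists_algEquiv_of_congr (B B' : LinearMap.BilinForm K (Fin q → K))
    (L : (Fin q → K) ≃ₗ[K] (Fin q → K)) (h : LinearMap.BilinForm.congr L B = B') :
    ∃ e : (ofBilin B).Alg ≃ₐ[K] (ofBilin B').Alg,
      (Submodule.span K (Set.range (ofBilin B).gen)).map e.toAlgHom.toLinearMap =
        Submodule.span K (Set.range (ofBilin B').gen) := by
  obtain ⟨f, hf⟩ := exists_algHom_of_congr B B' L h
  have h' : LinearMap.BilinForm.congr L.symm B' = B := by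
    rw [← h, ← LinearMap.BilinForm.congr_symm, LinearEquiv.symm_apply_apply]
  obtain ⟨g, hg⟩ := exists_algHom_of_congr B' B L.symm h'
  have key : ∀ (L : (Fin q → K) ≃ₗ[K] (Fin q → K)) (i l : Fin q),
      ∑ k, L.symm (Pi.single k 1) i * L (Pi.single l 1) k = if i = l then 1 else 0 := by
    intro L i l
    have e : L (Pi.single l 1) = ∑ k, L (Pi.single l 1) k • Pi.single k (1 : K) := by
      ext j
      simp [Pi.single_apply]
    have h := congrFun (L.symm_apply_apply (Pi.single l 1)) i
    rw [e, map_sum] at h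
    simpa [Pi.single_apply, mul_comm] using h
  have hgf : g.comp f = AlgHom.id K _ := by
    refine AlgHom.ext_of_adjoin_eq_top (ofBilin B).adjoin_gen ?_
    rintro _ ⟨i, rfl⟩
    simp only [AlgHom.comp_apply, hf, map_sum, map_smul, hg, Finset.smul_sum, smul_smul,
      LinearEquiv.symm_symm, AlgHom.id_apply]
    rw [Finset.sum_comm]
    simp only [← Finset.sum_smul, key, ite_smul, one_smul, zero_smul]
    simp
  have hfg : f.comp g = AlgHom.id K _ := by
    refine AlgHom.ext_of_adjoin_eq_top (ofBilin B').adjoin_gen ?_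
    rintro _ ⟨i, rfl⟩
    simp only [AlgHom.comp_apply, hf, map_sum, map_smul, hg, Finset.smul_sum, smul_smul,
      LinearEquiv.symm_symm, AlgHom.id_apply]
    rw [Finset.sum_comm]
    have key' := key L.symm
    simp only [LinearEquiv.symm_symm] at key'
    simp only [← Finset.sum_smul, key', ite_smul, one_smul, zero_smul]
    simp
  have hmem : ∀ (P : QuadraticData K q) (c : Fin q → K),
      ∑ k, c k • P.gen k ∈ Submodule.span K (Set.range P.gen) := fun P c =>
    Submodule.sum_mem _ fun k _ => Submodule.smul_mem _ _ (Submodule.subset_span ⟨k, rfl⟩)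
  refine ⟨AlgEquiv.ofAlgHom f g hfg hgf, le_antisymm ?_ ?_⟩
  · rw [Submodule.map_span_le]
    rintro _ ⟨i, rfl⟩
    change f _ ∈ _
    rw [hf]
    exact hmem _ _
  · rw [Submodule.span_le]
    rintro _ ⟨i, rfl⟩
    refine ⟨g ((ofBilin B').gen i), ?_, AlgHom.congr_fun hfg _⟩
    rw [SetLike.mem_coe, hg]
    exact hmem _ _

end QuadraticData

end

theorem theorem2p1 {K : Type u} [Field K] [IsAlgClosed K] [CharZero K] (q : ℕ) (hq : 2 ≤ q) :
    (∀ B : LinearMap.BilinForm K (Fin q → K), B.Nondegenerate →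
      (QuadraticData.ofBilin B).IsKoszul ∧
      leftGlobalDimension (QuadraticData.ofBilin B).Alg = 2 ∧
      (QuadraticData.ofBilin B).IsGorenstein 2) ∧
    (∀ P : QuadraticData K q,
      P.IsKoszul → leftGlobalDimension P.Alg = 2 → P.IsGorenstein 2 →
      ∃ B : LinearMap.BilinForm K (Fin q → K),
        B.Nondegenerate ∧ P = QuadraticData.ofBilin B) ∧
    (∀ B B' : LinearMap.BilinForm K (Fin q → K), B.Nondegenerate → B'.Nondegenerate →
      (∃ L : (Fin q → K) ≃ₗ[K] (Fin q → K), LinearMap.BilinForm.congr L B = B') →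
      ∃ e : (QuadraticData.ofBilin B).Alg ≃ₐ[K] (QuadraticData.ofBilin B').Alg,
        (Submodule.span K (Set.range (QuadraticData.ofBilin B).gen)).map
            e.toAlgHom.toLinearMap =
          Submodule.span K (Set.range (QuadraticData.ofBilin B').gen)) := by
  refine ⟨fun B hB => ?_, fun P hP hgl hG => ?_, fun B B' _ _ ⟨L, hL⟩ =>
    QuadraticData.exists_algEquiv_of_congr B B' L hL⟩
  · have hC := (QuadraticData.isUnit_det_componentMatrix_iff B).2 hB
    have hrel := QuadraticData.ofBilin_rel B
    exact ⟨QuadraticData.isKoszul hrel hq hC, QuadraticData.leftGlobalDimension_eq_two hrel hq hC,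
      QuadraticData.isGorenstein hrel hq hC⟩
  · obtain ⟨C, hC, hrel⟩ := QuadraticData.exists_matrix_of_isGorenstein hP hgl hG
    refine ⟨Matrix.toBilin' C, ?_, QuadraticData.ext ?_⟩
    · rwa [← QuadraticData.isUnit_det_componentMatrix_iff, QuadraticData.componentMatrix_toBilin']
    · rw [QuadraticData.ofBilin_rel, QuadraticData.componentMatrix_toBilin', hrel]
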